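/- Setting. Let $T>0$ and let $(\Omega,\mathcal F,P)$ be a complete probability space carrying an $\mathbb R^m$-valued càdlàg process $Y=(Y_t)_{t\in[0,T]}$ with independent increments and a random variable $\xi$, uniform on $[0,1]$ and independent of $Y$. Let $\mathcal F_t$ be generated by $(Y_s)_{s\le t}$ and the $P$-null events, $\mathcal G_t=\sigma\{\mathcal F_t,\xi\}$, $\mathbb F=(\mathcal F_t)$, $\mathbb G=(\mathcal G_t)$. Products $\odot$ and quotients of vectors in $\mathbb R^d$, $d\ge1$, are component-wise. Let $S$ be a continuous $\mathbb F$-adapted $\mathbb R^d$-valued process with strictly positive entries, $S^1\equiv1$ and $S_0=(1,\dots,1)$. Let $K\subset\mathbb R^d$ be a closed convex cone with $K\cap(-K)=\{0\}$ and $\mathbb R^d_+\subset K$, let $K^*=\{y: xy\ge0\ \forall x\in K\}$, and let $\ell(x)=\sup\{y\in\mathbb R: x-ye_1\in K\}$, where $e_1$ is the first basis vector. A strategy is a $\mathbb G$-adapted càdlàg $\mathbb R^d$-valued process $B=(B_t)_{t\in[0,T]}$ that is $K$-decreasing with the convention $B_{0-}=0$: $-B_0\in K$, and $B_s-B_t\in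 K$ for $0\le s\le t\le T$ (its paths then have finite variation). For $x\in K$ put $$\widehat V^{x,B}_t=x+\int_{[0,t]}\frac1{S_s}\,dB_s,\qquad V^{x,B}_t=S_t\odot\widehat V^{x,B}_t,$$ where the integral is the component-wise pathwise Lebesgue–Stieltjes integral, $dB$ having the atom $B_0$ at time $0$. Let $\mathcal A(x)$ be the set of strategies $B$ with $V^{x,B}_t\in K$ a.s. for every $t\in[0,T]$. A consistent price system is an $\mathbb R^d_+$-valued right-continuous $\mathbb F$-martingale $Z$ with $Z_t/S_t\in K^*\setminus\{0\}$ a.s. for every $t\in[0,T]$. Lemma. Let $U:\mathbb R^d\times\mathbb R^d\to[-\infty,\infty]$ be upper semicontinuous, and let $C>0$, $\gamma\in(0,1)$ and $q>1/(1-\gamma)$ be such that (i) $U(x,s)\le C(1+\ell(x)^\gamma)$ for all $(x,s)\in K\times\mathbb R^d_+$; (ii) there exists a consistent price system $Z$ with $E\big(Z^{(1)}_T\big)^{1-q}<\infty$ (where $0^{1-q}=+\infty$). Then, for every $x\in K$, the family $\{U^+(V^{x,B}_T,S_T): B\in\mathcal A(x)\}$ is uniformly integrable. Thus (since $U$ is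 upper semicontinuous) the standing assumption on $U$, namely upper semicontinuity together with this uniform integrability for every $x\in K$, holds. -/

import Mathlib

open MeasureTheory ProbabilityTheory Set Filter Topology

noncomputable section

namespace ConicMarket

/-- `ℝᵈ` with its Euclidean structure. -/
abbrev Vec (d : ℕ) : Type := EuclideanSpace ℝ (Fin d)

/-- The time interval `[0, T]`. -/
abbrev Time (T : ℝ) : Type := Set.Icc (0 : ℝ) T

/-- The time `0`, as an element of `[0, T]`. -/
def timeZero (T : ℝ) [hT : Fact (0 < T)] : Time T := ⟨0, le_rfl, hT.out.le⟩

/-- The terminal time `T`, as an element of `[0, T]`. -/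
def timeEnd (T : ℝ) [hT : Fact (0 < T)] : Time T := ⟨T, hT.out.le, le_rfl⟩

instance compactIccSpace_time (T : ℝ) : CompactIccSpace (Time T) :=
  ⟨fun {_ _} => isClosed_Icc.isCompact⟩

/-- Right continuity of a path on `[0, T]`. -/
def IsRightContinuousPath {T : ℝ} {n : ℕ} (f : Time T → Vec n) : Prop :=
  ∀ t, ContinuousWithinAt f (Set.Ici t) t

/-- A càdlàg path on `[0, T]`: right-continuous with left limits. -/
def IsCadlagPath {T : ℝ} {n : ℕ} (f : Time T → Vec n) : Prop :=
  IsRightContinuousPath f ∧ ∀ t, ∃ l, Tendsto f (𝓝[<] t) (𝓝 l)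

/-! ### Component-wise operations and cones -/

/-- Component-wise (Hadamard) product `x ⊙ y`. -/
def hmul {d : ℕ} (x y : Vec d) : Vec d := WithLp.toLp 2 fun i => x i * y i

/-- Component-wise quotient `x / y`. -/
def hdiv {d : ℕ} (x y : Vec d) : Vec d := WithLp.toLp 2 fun i => x i / y i

/-- The closed nonnegative orthant of `ℝᵈ`. -/
def orthant (d : ℕ) : Set (Vec d) := {x | ∀ i, 0 ≤ x i}

/-- The first vector `e₁` of the standard basis. -/
def e₁ (d : ℕ) [NeZero d] : Vec d := EuclideanSpace.single 0 1

/-- The cones describing transaction costs: a `ProperCone` of Mathlib is a nonempty closed convex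
cone; in addition the cone is pointed, `K ∩ (-K) = {0}`, and contains the nonnegative orthant. -/
structure IsSolvencyCone {d : ℕ} (K : ProperCone ℝ (Vec d)) : Prop where
  inter_neg : (K : Set (Vec d)) ∩ {x | -x ∈ K} = {0}
  orthant_subset : orthant d ⊆ (K : Set (Vec d))

/-- The liquidation function `ℓ(x) = sup {y ∈ ℝ : x - y e₁ ∈ K}`. For `x ∈ K` the set is nonempty
(it contains `0`) and bounded above (as `-e₁ ∉ K`), so this is a genuine real supremum. -/
def liquidation {d : ℕ} [NeZero d] (K : ProperCone ℝ (Vec d)) (x : Vec d) : ℝ :=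
  sSup {y : ℝ | x - y • e₁ d ∈ K}

/-! ### Stochastic basis -/

variable {Ω : Type*} [mΩ : MeasurableSpace Ω]

/-- The σ-algebra generated by the `μ`-null events. -/
abbrev nullAlgebra (μ : Measure Ω) : MeasurableSpace Ω :=
  MeasurableSpace.generateFrom {N | MeasurableSet N ∧ μ N = 0}

theorem nullAlgebra_le (μ : Measure Ω) : nullAlgebra μ ≤ mΩ :=
  MeasurableSpace.generateFrom_le fun _ h => h.1

/-- The filtration `𝔽`: `𝓕ₜ` is generated by `Y_s`, `s ≤ t`, and the null events. -/
def filF {T : ℝ} {m : ℕ} (μ : Measure Ω) (Y : Time T → Ω → Vec m)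
    (hY : ∀ t, StronglyMeasurable (Y t)) : Filtration (Time T) mΩ :=
  Filtration.natural Y hY ⊔ Filtration.const (Time T) (nullAlgebra μ) (nullAlgebra_le μ)

/-- The filtration `𝔾`: `𝓖ₜ` is generated by `𝓕ₜ` and the randomisation variable `ξ`. -/
def filG {T : ℝ} {m : ℕ} (μ : Measure Ω) (Y : Time T → Ω → Vec m)
    (hY : ∀ t, StronglyMeasurable (Y t)) (ξ : Ω → ℝ) (hξ : Measurable ξ) :
    Filtration (Time T) mΩ :=
  filF μ Y hY ⊔ Filtration.const (Time T) (MeasurableSpace.comap ξ inferInstance) hξ.comap_le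

/-- The driving process `Y` is càdlàg with independent increments and `ξ` is uniform on `[0, 1]`
and independent of (the whole path of) `Y`. -/
structure IsDriving {T : ℝ} {m : ℕ} (μ : Measure Ω) (Y : Time T → Ω → Vec m) (ξ : Ω → ℝ) :
    Prop where
  cadlag : ∀ ω, IsCadlagPath fun t => Y t ω
  indep_increments : HasIndepIncrements Y μ
  uniform : pdf.IsUniform ξ (Set.Icc 0 1) μ volume
  indep : IndepFun (fun ω t => Y t ω) ξ μ

/-! ### The market -/

/-- Price processes: continuous, adapted, with strictly positive entries, the first asset being
the numeraire (`S¹ ≡ 1`), normalised by `S₀ = (1, …, 1)`. -/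
structure IsPriceProcess {T : ℝ} [Fact (0 < T)] {d : ℕ} [NeZero d]
    (𝓕 : Filtration (Time T) mΩ) (S : Time T → Ω → Vec d) : Prop where
  adapted : ∀ t, Measurable[𝓕 t] (S t)
  continuous : ∀ ω, Continuous fun t => S t ω
  pos : ∀ t ω i, 0 < S t ω i
  numeraire : ∀ t ω, S t ω 0 = 1
  initial : ∀ ω i, S (timeZero T) ω i = 1

/-- A path `f` on `[0, T]` is `K`-decreasing when `f(s) - f(t) ∈ K` for `s ≤ t`, where the time
`0-`, with the convention `f(0-) = 0`, is included. -/
structure IsKDecreasing {T : ℝ} [Fact (0 < T)] {d : ℕ} (K : ProperCone ℝ (Vec d))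
    (f : Time T → Vec d) : Prop where
  initial : 0 - f (timeZero T) ∈ K
  sub_mem : ∀ s t, s ≤ t → f s - f t ∈ K

/-- Strategies: `𝔾`-adapted càdlàg `K`-decreasing processes. -/
structure IsStrategy {T : ℝ} [Fact (0 < T)] {d : ℕ} (𝓖 : Filtration (Time T) mΩ)
    (K : ProperCone ℝ (Vec d)) (B : Time T → Ω → Vec d) : Prop where
  adapted : ∀ t, Measurable[𝓖 t] (B t)
  cadlag : ∀ ω, IsCadlagPath fun t => B t ω
  decreasing : ∀ ω, IsKDecreasing K fun t => B t ω

open scoped Classical in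
/-- The Lebesgue--Stieltjes integral `∫_{[0,t]} f dg` of a function against a right-continuous
function `g` of bounded variation, with `g(0-) = 0`, so that `dg` has the atom `g(0)` at `0`.
Mathlib's measure attached to `g` on `[0, T]` has no atom at `0`, hence the separate first term.
(Components of `K`-decreasing paths, `K` pointed, are of bounded variation, so that the default
value `0` is not used for them.) -/
def stieltjesIntegral {T : ℝ} [Fact (0 < T)] (f g : Time T → ℝ) (t : Time T) : ℝ :=
  f (timeZero T) * g (timeZero T) +
    if hg : BoundedVariationOn g Set.univ then
      ∫ᵛ s in Set.Ioc (timeZero T) t, f s ∂•hg.vectorMeasure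
    else 0

/-- The portfolio in physical units, `V̂ = x + (1/S) · B`, the integral being component-wise. -/
def physicalValue {T : ℝ} [Fact (0 < T)] {d : ℕ} (S : Time T → Ω → Vec d) (x : Vec d)
    (B : Time T → Ω → Vec d) (t : Time T) (ω : Ω) : Vec d :=
  WithLp.toLp 2 fun i => x i + stieltjesIntegral (fun s => 1 / S s ω i) (fun s => B s ω i) t

/-- The portfolio in terms of the numeraire, `V = S ⊙ V̂`. -/
def portfolioValue {T : ℝ} [Fact (0 < T)] {d : ℕ} (S : Time T → Ω → Vec d) (x : Vec d)
    (B : Time T → Ω → Vec d) (t : Time T) (ω : Ω) : Vec d :=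
  hmul (S t ω) (physicalValue S x B t ω)

/-- The set `𝓐(x)` of admissible strategies: `V_t ∈ K` a.s. for every `t`. -/
def admissible {T : ℝ} [Fact (0 < T)] {d : ℕ} (μ : Measure Ω) (𝓖 : Filtration (Time T) mΩ)
    (K : ProperCone ℝ (Vec d)) (S : Time T → Ω → Vec d) (x : Vec d) :
    Set (Time T → Ω → Vec d) :=
  {B | IsStrategy 𝓖 K B ∧ ∀ t, ∀ᵐ ω ∂μ, portfolioValue S x B t ω ∈ K}

/-- Consistent price systems: right-continuous `𝔽`-martingales `Z` with values in the nonnegative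
orthant such that `Z_t / S_t ∈ K^* \ {0}` a.s. for every `t`. -/
structure IsCPS {T : ℝ} {d : ℕ} (μ : Measure Ω) (𝓕 : Filtration (Time T) mΩ)
    (K : ProperCone ℝ (Vec d)) (S : Time T → Ω → Vec d) (Z : Time T → Ω → Vec d) : Prop where
  mem_orthant : ∀ t ω, Z t ω ∈ orthant d
  right_continuous : ∀ ω, IsRightContinuousPath fun t => Z t ω
  martingale : Martingale Z 𝓕 μ
  mem_dual : ∀ t, ∀ᵐ ω ∂μ,
    hdiv (Z t ω) (S t ω) ∈ ProperCone.innerDual (K : Set (Vec d)) ∧ hdiv (Z t ω) (S t ω) ≠ 0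

/-- The condition on the utility `U`: it is upper semicontinuous and, for every `x ∈ K`, the family
`{U⁺(V_T, S_T) : B ∈ 𝓐(x)}` is uniformly integrable, that is, `U⁺(V_T, S_T)` is a.s. finite and the
resulting real random variables are uniformly integrable. `EReal.toENNReal` is the positive part,
with values in `[0, ∞]`. -/
def UtilityCondition {T : ℝ} [Fact (0 < T)] {d : ℕ} (μ : Measure Ω)
    (𝓖 : Filtration (Time T) mΩ) (K : ProperCone ℝ (Vec d)) (S : Time T → Ω → Vec d)
    (U : Vec d × Vec d → EReal) : Prop :=
  UpperSemicontinuous U ∧ ∀ x ∈ K,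
    (∀ B ∈ admissible μ 𝓖 K S x, ∀ᵐ ω ∂μ,
      U (portfolioValue S x B (timeEnd T) ω, S (timeEnd T) ω) ≠ ⊤) ∧
    UniformIntegrable
      (fun (B : admissible μ 𝓖 K S x) ω =>
        (U (portfolioValue S x B.1 (timeEnd T) ω, S (timeEnd T) ω)).toENNReal.toReal) 1 μ

end ConicMarket

end

noncomputable section

/-! ### Pointed cones: dual vectors, liquidation value, bounded variation of strategies -/

namespace ConicMarket

open scoped InnerProductSpace

/-! Write `X` for the physical portfolio. The heart of the proof is a budget constraint,
`lintegral_physicalValue_le`: under a consistent price system, the mean of the positive part of `∑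
i, X_T i * Z_T i` is at most that of `∑ i, |x i| * Z_T i`, whatever the admissible strategy. Dual
pairing gives `ℓ(V_T) * Z_T 0 ≤ ∑ i, X_T i * Z_T i`. Hölder's inequality, with the negative moment
of `Z_T 0`, then bounds the moment of `ℓ(V_T)` of order `(q - 1) / q`. By the growth condition this
bounds the moment of `U⁺` of order `r = (q - 1) / q / γ`. Since `q > 1 / (1 - γ)` says exactly that
`r > 1`, the family is bounded in `L^r`, hence uniformly integrable.

The budget constraint is a supermartingale property, obtained by discretisation. The integral is
approximated by Riemann sums with right tags: a trade over a grid cell is then executed at the price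
of its right end, where pairing it with `Z / S` in the dual cone gives a nonpositive value with no
error. Strategies are adapted to `𝔾` and `Z` is an `𝔽`-martingale, but `ξ` is independent of `𝔽`, so
`Z` may be tested against bounded `𝔾`-measurable variables (`IsCPS.integral_mul_eq`).

To have bounded test variables, the discrete portfolio is replaced by `0` as soon as a coordinate
exceeds `N`. This costs at most the shortfall from solvency of the portfolio being dropped
(`integral_frozen_le`, `neg_shortfall_le`). Admissibility and continuity of `S` make the shortfall
vanish along almost every path as the mesh tends to zero (`eventually_shortfall_lt`). Fatou's lemma,
first in the mesh and then in `N`, finishes the argument. -/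

theorem IsSolvencyCone.exists_mem_dual_pos {d : ℕ} {K : ProperCone ℝ (Vec d)}
    (hK : IsSolvencyCone K) {x : Vec d} (hx : x ∈ K) (hx0 : x ≠ 0) :
    ∃ y ∈ ProperCone.innerDual (K : Set (Vec d)), 0 < ⟪x, y⟫_ℝ := by
  have hnx : -x ∉ K := fun h => hx0 (by
    have : x ∈ (K : Set (Vec d)) ∩ {x | -x ∈ K} := ⟨hx, h⟩
    rw [hK.inter_neg] at this
    exact this)
  obtain ⟨y, hy, hyx⟩ := ProperCone.hyperplane_separation' K hnx
  refine ⟨y, by simpa [ProperCone.mem_innerDual] using hy, ?_⟩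
  simpa [inner_neg_left] using hyx

/-- A pointed closed cone has a dual vector that dominates the norm on the cone. -/
theorem IsSolvencyCone.exists_dual_ge_norm {d : ℕ} {K : ProperCone ℝ (Vec d)}
    (hK : IsSolvencyCone K) :
    ∃ y : Vec d, ∃ c : ℝ, 0 < c ∧ ∀ x ∈ K, c * ‖x‖ ≤ ⟪x, y⟫_ℝ := by
  let D : Set (Vec d) := (K : Set (Vec d)) ∩ Metric.sphere 0 1
  have hD : IsCompact D := (isCompact_sphere (0 : Vec d) 1).inter_left K.isClosed
  have hne : ∀ x ∈ D, x ≠ 0 := fun x hx h => by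
    have := hx.2
    simp [h] at this
  -- Each point of `D` has a dual vector positive near it. By compactness finitely many suffice, and
  -- their sum is positive on all of `D`, since each summand is nonnegative on `K`.
  have key : ∃ y ∈ ProperCone.innerDual (K : Set (Vec d)), ∀ x ∈ D, 0 < ⟪x, y⟫_ℝ := by
    refine hD.induction_on (p := fun s => ∃ y ∈ ProperCone.innerDual (K : Set (Vec d)),
      ∀ x ∈ s ∩ D, 0 < ⟪x, y⟫_ℝ) ⟨0, zero_mem _, by simp⟩ ?_ ?_ ?_ |>.imp fun y h => ⟨h.1, fun x hx => h.2 x ⟨hx, hx⟩⟩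
    · rintro s t hst ⟨y, hy, h⟩
      exact ⟨y, hy, fun x hx => h x ⟨hst hx.1, hx.2⟩⟩
    · rintro s t ⟨y, hy, h⟩ ⟨z, hz, h'⟩
      refine ⟨y + z, add_mem hy hz, fun x hx => ?_⟩
      rw [inner_add_right]
      have hy' := hy hx.2.1
      have hz' := hz hx.2.1
      simp only [innerₗ_apply_apply] at hy' hz'
      rcases hx.1 with h1 | h1
      · exact add_pos_of_pos_of_nonneg (h x ⟨h1, hx.2⟩) hz'
      · exact add_pos_of_nonneg_of_pos hy' (h' x ⟨h1, hx.2⟩)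
    · intro x hx
      obtain ⟨y, hy, hxy⟩ := hK.exists_mem_dual_pos hx.1 (hne x hx)
      refine ⟨{z | 0 < ⟪z, y⟫_ℝ}, mem_nhdsWithin_of_mem_nhds
        ((isOpen_lt continuous_const (by fun_prop)).mem_nhds hxy), y, hy, fun z hz => hz.1⟩
  obtain ⟨y, -, hy⟩ := key
  obtain ⟨c, hc, hcD⟩ : ∃ c : ℝ, 0 < c ∧ ∀ x ∈ D, c ≤ ⟪x, y⟫_ℝ := by
    rcases D.eq_empty_or_nonempty with h | h
    · exact ⟨1, one_pos, by simp [h]⟩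
    · obtain ⟨x, hx, hmin⟩ := hD.exists_isMinOn h (f := fun z => ⟪z, y⟫_ℝ) (by fun_prop)
      exact ⟨_, hy x hx, fun z hz => hmin hz⟩
  refine ⟨y, c, hc, fun x hx => ?_⟩
  rcases eq_or_ne x 0 with rfl | h0
  · simp
  have hn : 0 < ‖x‖ := norm_pos_iff.2 h0
  have := hcD (‖x‖⁻¹ • x) ⟨ProperCone.smul_mem K hx (by positivity), by
    simp [norm_smul, hn.ne']⟩
  rw [inner_smul_left] at this
  simp only [map_inv₀, conj_trivial] at this
  rw [inv_mul_eq_div, le_div_iff₀ hn] at this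
  exact this

/-- Pairing with a dual vector that is strictly positive at `e₁` bounds the defining set above. As
`K` is closed, the supremum is attained. -/
theorem liquidation_spec {d : ℕ} [NeZero d] {K : ProperCone ℝ (Vec d)} (hK : IsSolvencyCone K)
    {x : Vec d} (hx : x ∈ K) :
    0 ≤ liquidation K x ∧ x - liquidation K x • e₁ d ∈ K := by
  obtain ⟨y, c, hc, hy⟩ := hK.exists_dual_ge_norm
  have he : e₁ d ∈ K := hK.orthant_subset fun i => by
    by_cases h : i = 0 <;> simp [e₁, h]
  have hey : 0 < ⟪e₁ d, y⟫_ℝ := lt_of_lt_of_le (by simpa [e₁] using hc) (hy _ he)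
  have h0 : (0 : ℝ) ∈ {y : ℝ | x - y • e₁ d ∈ K} := by simpa using hx
  have hb : BddAbove {y : ℝ | x - y • e₁ d ∈ K} := by
    refine ⟨⟪x, y⟫_ℝ / ⟪e₁ d, y⟫_ℝ, fun a ha => ?_⟩
    rw [le_div_iff₀ hey]
    have h1 := (mul_nonneg hc.le (norm_nonneg _)).trans (hy _ ha)
    rw [inner_sub_left, inner_smul_left] at h1
    simp only [conj_trivial] at h1
    linarith
  refine ⟨le_csSup hb h0, ?_⟩
  have hcl : IsClosed {y : ℝ | x - y • e₁ d ∈ K} :=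
    K.isClosed.preimage (f := fun a : ℝ => x - a • e₁ d) (by fun_prop)
  exact hcl.csSup_mem ⟨0, h0⟩ hb

/-- A dual vector dominating the norm on `K` turns the path into a scalar monotone function `g`
whose increments dominate those of every coordinate. -/
theorem IsKDecreasing.boundedVariationOn {T : ℝ} [Fact (0 < T)] {d : ℕ}
    {K : ProperCone ℝ (Vec d)} (hK : IsSolvencyCone K) {f : Time T → Vec d}
    (hf : IsKDecreasing K f) (i : Fin d) : BoundedVariationOn (fun t => f t i) univ := by
  obtain ⟨y, c, hc, hy⟩ := hK.exists_dual_ge_norm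
  let g : Time T → ℝ := fun t => - (c⁻¹ * ⟪f t, y⟫_ℝ)
  have hfg : ∀ s t, s ≤ t → ‖f s i - f t i‖ ≤ g t - g s := fun s t hst => by
    have h1 := hy _ (hf.sub_mem s t hst)
    have h2 : ‖f s i - f t i‖ ≤ ‖f s - f t‖ := by
      simpa using PiLp.norm_apply_le (f s - f t) i
    rw [inner_sub_left] at h1
    have : g t - g s = (⟪f s, y⟫_ℝ - ⟪f t, y⟫_ℝ) / c := by simp only [g]; field_simp; ring
    rw [this, le_div_iff₀ hc]
    nlinarith
  have hg : Monotone g := fun s t hst => by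
    have := (norm_nonneg _).trans (hfg s t hst)
    linarith
  have hgb : BoundedVariationOn g univ := by
    have h0 : ∀ t : Time T, timeZero T ≤ t := fun t => t.2.1
    have h1 : ∀ t : Time T, t ≤ timeEnd T := fun t => t.2.2
    have : (univ : Set (Time T)) = univ ∩ Icc (timeZero T) (timeEnd T) := by
      ext t; simp [h0 t, h1 t]
    rw [this]
    exact (hg.monotoneOn univ).locallyBoundedVariationOn _ _ (mem_univ _) (mem_univ _)
  refine ne_top_of_le_ne_top hgb ?_
  refine iSup_le fun p => le_trans ?_ (eVariationOn.sum_le (f := g) (s := univ) p.2.2.1 (fun j => mem_univ _) (n := p.1))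
  refine Finset.sum_le_sum fun j _ => ?_
  have hj : (p.2 : ℕ → Time T) j ≤ (p.2 : ℕ → Time T) (j + 1) := p.2.2.1 (Nat.le_succ j)
  rw [edist_comm, edist_comm (g _), edist_dist, edist_dist]
  refine ENNReal.ofReal_le_ofReal ?_
  rw [dist_eq_norm, Real.dist_eq]
  refine (hfg _ _ hj).trans ?_
  rw [abs_sub_comm]
  exact le_abs_self _

end ConicMarket

/-! ### Lebesgue–Stieltjes integrals as limits of right-tagged Riemann sums -/

namespace ConicMarket

instance isFiniteMeasure_variation {X : Type*} [MeasurableSpace X] (s : SignedMeasure X) :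
    IsFiniteMeasure (VectorMeasure.variation s) := by
  rw [← SignedMeasure.totalVariation_eq_variation]
  infer_instance

/-- Riemann sums with right tags along `t₀ = 0 ≤ t₁ ≤ …`, with the atom at `0`. -/
def riemannSum {T : ℝ} [Fact (0 < T)] (f g : Time T → ℝ) (t : ℕ → Time T) (k : ℕ) : ℝ :=
  f (timeZero T) * g (timeZero T) +
    ∑ j ∈ Finset.range k, f (t (j + 1)) * (g (t (j + 1)) - g (t j))

theorem abs_stieltjesIntegral_sub_riemannSum_le {T : ℝ} [Fact (0 < T)] {f g : Time T → ℝ}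
    (hf : Continuous f) (hg : BoundedVariationOn g univ)
    (hgr : ∀ t, ContinuousWithinAt g (Ici t) t) {t : ℕ → Time T} (ht : Monotone t)
    (h0 : t 0 = timeZero T) {ε : ℝ} (hε0 : 0 ≤ ε)
    (hε : ∀ k, ∀ s ∈ Ioc (t k) (t (k + 1)), |f s - f (t (k + 1))| ≤ ε) (k : ℕ) :
    |stieltjesIntegral f g (t k) - riemannSum f g t k| ≤
      ε * (VectorMeasure.variation hg.vectorMeasure).real univ := by
  set m : VectorMeasure (Time T) ℝ := hg.vectorMeasure with hm
  have : IsFiniteMeasure m.variation := isFiniteMeasure_variation m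
  have hfi : Integrable f m.variation := by
    have := hf.continuousOn.integrableOn_compact (μ := m.variation) (isCompact_univ)
    simpa using this
  have hfs : ∀ s, MeasurableSet s → m.IntegrableOn f s := fun s hs =>
    VectorMeasure.Integrable.integrableOn hfi
  -- The measure of `g` is expressed by right limits; right continuity identifies these with the
  -- values of `g`.
  have hIoc : ∀ a b, a ≤ b → m (Ioc a b) = g b - g a := fun a b hab => by
    rw [hm, hg.vectorMeasure_Ioc hab, (hgr a).rightLim_eq, (hgr b).rightLim_eq]
  have h0k : ∀ k, timeZero T ≤ t k := fun k => h0 ▸ ht (Nat.zero_le k)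
  have key : |∫ᵛ s in Ioc (timeZero T) (t k), f s ∂•m -
      ∑ j ∈ Finset.range k, f (t (j + 1)) * (g (t (j + 1)) - g (t j))| ≤
      ε * m.variation.real (Ioc (timeZero T) (t k)) := by
    induction k with
    | zero => simp [h0]
    | succ k ih =>
      have hst := ht (Nat.le_succ k)
      have hd : Disjoint (Ioc (timeZero T) (t k)) (Ioc (t k) (t (k + 1))) :=
        Set.disjoint_left.2 fun x hx hx' => absurd hx.2 (not_le.2 hx'.1)
      have hu := Ioc_union_Ioc_eq_Ioc (h0k k) hst
      have h1 := VectorMeasure.setIntegral_union (B := ContinuousLinearMap.lsmul ℝ ℝ) hd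
        measurableSet_Ioc measurableSet_Ioc (hfs _ measurableSet_Ioc) (hfs _ measurableSet_Ioc)
      have h2 : ∫ᵛ s in Ioc (t k) (t (k + 1)), (f s - f (t (k + 1))) ∂•m =
          ∫ᵛ s in Ioc (t k) (t (k + 1)), f s ∂•m -
            f (t (k + 1)) * (g (t (k + 1)) - g (t k)) := by
        rw [VectorMeasure.integral_fun_sub (hfs _ measurableSet_Ioc)
          (VectorMeasure.Integrable.integrableOn (integrable_const _)), VectorMeasure.setIntegral_const, hIoc _ _ hst]
        simp
      have h3 := VectorMeasure.norm_setIntegral_le_of_norm_le_const (μ := m)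
        (B := ContinuousLinearMap.lsmul ℝ ℝ) (f := fun s => f s - f (t (k + 1))) (hε k)
      have h4 : ‖(ContinuousLinearMap.lsmul ℝ ℝ : ℝ →L[ℝ] ℝ →L[ℝ] ℝ)‖ ≤ 1 :=
        ContinuousLinearMap.opNorm_lsmul_le
      rw [h2, Real.norm_eq_abs] at h3
      have h5 : m.variation.real (Ioc (timeZero T) (t (k + 1))) =
          m.variation.real (Ioc (timeZero T) (t k)) + m.variation.real (Ioc (t k) (t (k + 1))) := by
        rw [← hu, measureReal_union hd measurableSet_Ioc]
      rw [← hu, h1, hu, h5, Finset.sum_range_succ]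
      have h6 : ε * ‖(ContinuousLinearMap.lsmul ℝ ℝ : ℝ →L[ℝ] ℝ →L[ℝ] ℝ)‖ *
          m.variation.real (Ioc (t k) (t (k + 1))) ≤
          ε * m.variation.real (Ioc (t k) (t (k + 1))) :=
        mul_le_mul_of_nonneg_right (mul_le_of_le_one_right hε0 h4) measureReal_nonneg
      rw [mul_add]
      calc _ = |(∫ᵛ s in Ioc (timeZero T) (t k), f s ∂•m -
              ∑ j ∈ Finset.range k, f (t (j + 1)) * (g (t (j + 1)) - g (t j))) +
              (∫ᵛ s in Ioc (t k) (t (k + 1)), f s ∂•m -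
                f (t (k + 1)) * (g (t (k + 1)) - g (t k)))| := by congr 1; ring
        _ ≤ _ := (abs_add_le _ _).trans (add_le_add ih (h3.trans h6))
  have hmono : m.variation.real (Ioc (timeZero T) (t k)) ≤ m.variation.real univ :=
    measureReal_mono (subset_univ _)
  refine le_trans (le_of_eq ?_) (key.trans (mul_le_mul_of_nonneg_left hmono hε0))
  rw [stieltjesIntegral, dif_pos hg, riemannSum]
  congr 1
  ring

/-- The uniform grid of mesh `T / n`, stationary at `T` from index `n` on. -/
def grid (T : ℝ) [hT : Fact (0 < T)] (n k : ℕ) : Time T :=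
  Set.projIcc 0 T hT.out.le (k * (T / n))

theorem grid_monotone (T : ℝ) [hT : Fact (0 < T)] (n : ℕ) : Monotone (grid T n) := fun i j hij =>
  Set.monotone_projIcc _ (mul_le_mul_of_nonneg_right (by exact_mod_cast hij)
    (div_nonneg hT.out.le (Nat.cast_nonneg n)))

theorem grid_zero (T : ℝ) [hT : Fact (0 < T)] (n : ℕ) : grid T n 0 = timeZero T := by
  simp [grid, timeZero]

theorem grid_of_le (T : ℝ) [hT : Fact (0 < T)] {n k : ℕ} (hn : 0 < n) (hk : n ≤ k) :
    grid T n k = timeEnd T := by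
  have : T ≤ k * (T / n) := by
    have h1 : (0 : ℝ) < n := by exact_mod_cast hn
    have h2 : (n : ℝ) ≤ k := by exact_mod_cast hk
    rw [mul_div_assoc', le_div_iff₀ h1]
    nlinarith [hT.out]
  rw [grid, Set.projIcc_of_right_le _ this, timeEnd]

theorem dist_grid_succ_le (T : ℝ) [hT : Fact (0 < T)] (n k : ℕ) :
    dist (grid T n k) (grid T n (k + 1)) ≤ T / n := by
  have h0 : 0 ≤ T / n := div_nonneg hT.out.le (Nat.cast_nonneg n)
  rw [Subtype.dist_eq, grid, grid, Real.dist_eq]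
  refine (Set.abs_projIcc_sub_projIcc hT.out.le).trans ?_
  push_cast
  rw [abs_sub_comm]
  ring_nf
  rw [abs_of_nonneg (by simpa [div_eq_mul_inv] using h0)]

/-- Oscillation of a continuous path over grid cells. -/
theorem eventually_dist_grid_lt {T : ℝ} [hT : Fact (0 < T)] {E : Type*} [PseudoMetricSpace E]
    {f : Time T → E} (hf : Continuous f) {ε : ℝ} (hε : 0 < ε) :
    ∀ᶠ n in atTop, ∀ k, ∀ s ∈ Icc (grid T n k) (grid T n (k + 1)),
      dist (f s) (f (grid T n (k + 1))) < ε := by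
  obtain ⟨δ, hδ, h⟩ := Metric.uniformContinuous_iff.1
    (CompactSpace.uniformContinuous_of_continuous hf) ε hε
  have hlim : Tendsto (fun n : ℕ => T / n) atTop (𝓝 0) := tendsto_const_div_atTop_nhds_zero_nat T
  filter_upwards [hlim.eventually_lt_const hδ] with n hn k s hs
  refine h (lt_of_le_of_lt ?_ hn)
  refine le_trans ?_ (dist_grid_succ_le T n k)
  have h1 : ((grid T n k : Time T) : ℝ) ≤ s := hs.1
  have h2 : (s : ℝ) ≤ (grid T n (k + 1) : Time T) := hs.2
  rw [Subtype.dist_eq, Subtype.dist_eq, Real.dist_eq, Real.dist_eq,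
    abs_of_nonpos (sub_nonpos.2 h2), abs_of_nonpos (sub_nonpos.2 (h1.trans h2))]
  linarith

/-- Riemann sums converge to the Lebesgue--Stieltjes integral uniformly over grid points. -/
theorem eventually_abs_stieltjesIntegral_sub_riemannSum_lt {T : ℝ} [Fact (0 < T)]
    {f g : Time T → ℝ} (hf : Continuous f) (hg : BoundedVariationOn g univ)
    (hgr : ∀ t, ContinuousWithinAt g (Ici t) t) {ε : ℝ} (hε : 0 < ε) :
    ∀ᶠ n in atTop, ∀ k,
      |stieltjesIntegral f g (grid T n k) - riemannSum f g (grid T n) k| < ε := by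
  set v := (VectorMeasure.variation hg.vectorMeasure).real univ
  have hv : 0 ≤ v := measureReal_nonneg
  have hδ : 0 < ε / (v + 1) := by positivity
  filter_upwards [eventually_dist_grid_lt hf hδ] with n hn k
  refine lt_of_le_of_lt (abs_stieltjesIntegral_sub_riemannSum_le hf hg hgr (grid_monotone T n)
    (grid_zero T n) hδ.le (fun k s hs => ?_) k) ?_
  · have := hn k s ⟨hs.1.le, hs.2⟩
    rw [Real.dist_eq] at this
    exact this.le
  · rw [div_mul_eq_mul_div, div_lt_iff₀ (by positivity)]
    nlinarith

/-- A Lebesgue--Stieltjes integral is bounded in its upper limit. -/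
theorem exists_abs_stieltjesIntegral_le {T : ℝ} [Fact (0 < T)]
    {f g : Time T → ℝ} (hf : Continuous f) (hg : BoundedVariationOn g univ) :
    ∃ C, ∀ t, |stieltjesIntegral f g t| ≤ C := by
  set m : VectorMeasure (Time T) ℝ := hg.vectorMeasure with hm
  have : IsFiniteMeasure m.variation := isFiniteMeasure_variation m
  obtain ⟨M, hM⟩ := isCompact_univ.exists_bound_of_continuousOn hf.continuousOn
  have hM0 : 0 ≤ M := (norm_nonneg _).trans (hM (timeZero T) (mem_univ _))
  refine ⟨|f (timeZero T) * g (timeZero T)| + M * m.variation.real univ, fun t => ?_⟩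
  rw [stieltjesIntegral, dif_pos hg]
  refine (abs_add_le _ _).trans (add_le_add le_rfl ?_)
  have h3 := VectorMeasure.norm_setIntegral_le_of_norm_le_const (μ := m)
    (B := ContinuousLinearMap.lsmul ℝ ℝ) (f := f) (s := Ioc (timeZero T) t)
    (fun s _ => hM s (mem_univ _))
  refine h3.trans ?_
  refine mul_le_mul ?_ (measureReal_mono (subset_univ _)) measureReal_nonneg hM0
  exact mul_le_of_le_one_right hM0 ContinuousLinearMap.opNorm_lsmul_le

end ConicMarket

/-! ### From `𝔽`-martingales to `𝔾`: independence of the randomisation -/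

namespace ConicMarket

/-- Independence is not affected by adding null events. -/
theorem indep_sup_nullAlgebra {Ω : Type*} {m₁ m₂ mΩ : MeasurableSpace Ω} {μ : Measure Ω}
    (h : Indep m₁ m₂ μ) : Indep (m₁ ⊔ nullAlgebra μ) m₂ μ := by
  -- Every event of the enlarged σ-algebra agrees almost surely with an event of `m₁`.
  have hle : m₁ ⊔ nullAlgebra μ ≤ eventuallyMeasurableSpace m₁ (ae μ) := by
    refine sup_le le_eventuallyMeasurableSpace (MeasurableSpace.generateFrom_le fun s hs => ?_)
    exact ⟨∅, @MeasurableSet.empty _ m₁, ae_eq_empty.2 hs.2⟩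
  rw [Indep_iff]
  intro s t hs ht
  obtain ⟨s', hs', hss'⟩ := hle s hs
  rw [measure_congr hss', measure_congr (hss'.inter (ae_eq_refl t))]
  exact (Indep_iff _ _ _).1 h s' t hs' ht

theorem indep_filF {Ω : Type*} [MeasurableSpace Ω] {T : ℝ} {m : ℕ} {μ : Measure Ω} {Y : Time T → Ω → Vec m}
    {hY : ∀ t, StronglyMeasurable (Y t)} {ξ : Ω → ℝ} (h : IsDriving μ Y ξ) (t : Time T) :
    Indep (filF μ Y hY t) (MeasurableSpace.comap ξ inferInstance) μ := by
  have h1 : Indep (MeasurableSpace.comap (fun ω t => Y t ω) MeasurableSpace.pi)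
      (MeasurableSpace.comap ξ inferInstance) μ := (IndepFun_iff_Indep _ _ _).1 h.indep
  have h2 : (Filtration.natural Y hY t : MeasurableSpace Ω) ≤
      MeasurableSpace.comap (fun ω t => Y t ω) MeasurableSpace.pi := by
    refine iSup₂_le fun s _ => ?_
    rintro u ⟨v, hv, rfl⟩
    refine ⟨(fun y : Time T → Vec m => y s) ⁻¹' v, ?_, rfl⟩
    exact measurable_pi_apply s hv
  exact indep_sup_nullAlgebra (indep_of_indep_of_le_left h1 h2)

/-- A conditional expectation is unaffected by enlarging the conditioning σ-algebra with an
independent one. -/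
theorem setIntegral_eq_of_indep {Ω : Type*} {m₁ m₂ m₃ mΩ : MeasurableSpace Ω} {μ : Measure Ω}
    [IsProbabilityMeasure μ] (h₁₃ : m₁ ≤ m₃) (h₃ : m₃ ≤ mΩ) (h₂ : m₂ ≤ mΩ)
    (hind : Indep m₃ m₂ μ) {f g : Ω → ℝ} (hf : StronglyMeasurable[m₃] f)
    (hg : StronglyMeasurable[m₃] g) (hfi : Integrable f μ) (hgi : Integrable g μ)
    (hfg : ∀ s, MeasurableSet[m₁] s → ∫ ω in s, f ω ∂μ = ∫ ω in s, g ω ∂μ)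
    {s : Set Ω} (hs : MeasurableSet[m₁ ⊔ m₂] s) : ∫ ω in s, f ω ∂μ = ∫ ω in s, g ω ∂μ := by
  have h₁ := h₁₃.trans h₃
  -- On rectangles `A ∩ B` the integral factorises because `m₂` is independent of all of `m₃`, where
  -- `f` lives, and not only of `m₁`. Rectangles form a π-system generating `m₁ ⊔ m₂`.
  have hprod : ∀ f : Ω → ℝ, StronglyMeasurable[m₃] f → Integrable f μ →
      ∀ A B, MeasurableSet[m₁] A → MeasurableSet[m₂] B →
      ∫ ω in A ∩ B, f ω ∂μ = (∫ ω in A, f ω ∂μ) * μ.real B := by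
    intro f hf hfi A B hA hB
    have hA' := h₁ _ hA
    have hB' := h₂ _ hB
    rw [← integral_indicator hA', ← integral_indicator (hA'.inter hB')]
    have hX : StronglyMeasurable[m₃] (A.indicator f) := hf.indicator (h₁₃ _ hA)
    have hYm : StronglyMeasurable[m₂] (B.indicator (fun _ => (1 : ℝ))) :=
      (stronglyMeasurable_const).indicator hB
    have hi : IndepFun (A.indicator f) (B.indicator (fun _ => (1 : ℝ))) μ := by
      rw [IndepFun_iff_Indep]
      exact indep_of_indep_of_le_left (indep_of_indep_of_le_right hind
        hYm.measurable.comap_le) hX.measurable.comap_le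
    have := hi.integral_mul_eq_mul_integral (hX.mono h₃).aestronglyMeasurable
      (hYm.mono h₂).aestronglyMeasurable
    rw [integral_indicator (f := fun _ => (1 : ℝ)) hB'] at this
    simp only [integral_const, smul_eq_mul, mul_one, measureReal_restrict_apply_univ] at this
    rw [← this]
    congr 1
    ext ω
    by_cases hωA : ω ∈ A <;> by_cases hωB : ω ∈ B <;> simp [hωA, hωB]
  have hgen : m₁ ⊔ m₂ = MeasurableSpace.generateFrom
      (image2 (· ∩ ·) {s | MeasurableSet[m₁] s} {s | MeasurableSet[m₂] s}) := by
    refine le_antisymm (sup_le (fun A hA => ?_) fun B hB => ?_)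
      (MeasurableSpace.generateFrom_le ?_)
    · exact MeasurableSpace.measurableSet_generateFrom
        ⟨A, hA, univ, @MeasurableSet.univ _ m₂, inter_univ A⟩
    · exact MeasurableSpace.measurableSet_generateFrom
        ⟨univ, @MeasurableSet.univ _ m₁, B, hB, univ_inter B⟩
    · rintro _ ⟨A, hA, B, hB, rfl⟩
      exact @MeasurableSet.inter _ (m₁ ⊔ m₂) _ _ (le_sup_left (a := m₁) _ hA)
        (le_sup_right (a := m₁) _ hB)
  have hpi : IsPiSystem (image2 (· ∩ ·) {s | MeasurableSet[m₁] s} {s | MeasurableSet[m₂] s}) := by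
    rintro _ ⟨A, hA, B, hB, rfl⟩ _ ⟨A', hA', B', hB', rfl⟩ -
    exact ⟨A ∩ A', @MeasurableSet.inter _ m₁ _ _ hA hA', B ∩ B',
      @MeasurableSet.inter _ m₂ _ _ hB hB', by ext; simp; tauto⟩
  have huniv : ∫ ω, f ω ∂μ = ∫ ω, g ω ∂μ := by
    simpa using hfg univ (@MeasurableSet.univ _ m₁)
  refine MeasurableSpace.induction_on_inter (C := fun s _ =>
    ∫ ω in s, f ω ∂μ = ∫ ω in s, g ω ∂μ) hgen hpi (by simp) ?_ ?_ ?_ s hs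
  · rintro _ ⟨A, hA, B, hB, rfl⟩
    simp only [hprod f hf hfi A B hA hB, hprod g hg hgi A B hA hB, hfg A hA]
  · intro t ht ih
    have ht' : MeasurableSet t := sup_le h₁ h₂ t ht
    have e1 := integral_add_compl ht' hfi
    have e2 := integral_add_compl ht' hgi
    linarith
  · intro F hd hF ih
    have hF' : ∀ i, MeasurableSet (F i) := fun i => sup_le h₁ h₂ _ (hF i)
    rw [integral_iUnion hF' hd hfi.integrableOn, integral_iUnion hF' hd hgi.integrableOn]
    exact tsum_congr ih

/-- Components of a consistent price system tested against bounded `𝔾`-measurable variables. -/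
theorem IsCPS.integral_mul_eq {Ω : Type*} [MeasurableSpace Ω] {T : ℝ} {m d : ℕ} {μ : Measure Ω} [IsProbabilityMeasure μ]
    {Y : Time T → Ω → Vec m} {hY : ∀ t, StronglyMeasurable (Y t)} {ξ : Ω → ℝ}
    {hξ : Measurable ξ} (h : IsDriving μ Y ξ) {K : ProperCone ℝ (Vec d)}
    {S Z : Time T → Ω → Vec d} (hZ : IsCPS μ (filF μ Y hY) K S Z) {s t : Time T} (hst : s ≤ t)
    (i : Fin d) {H : Ω → ℝ} (hH : Measurable[filG μ Y hY ξ hξ s] H) {C : ℝ}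
    (hC : ∀ ω, |H ω| ≤ C) :
    ∫ ω, H ω * Z s ω i ∂μ = ∫ ω, H ω * Z t ω i ∂μ := by
  have hle := (filG μ Y hY ξ hξ).le s
  have hint : ∀ t, Integrable (fun ω => Z t ω i) μ := fun t =>
    (EuclideanSpace.proj (𝕜 := ℝ) i : Vec d →L[ℝ] ℝ).integrable_comp (hZ.martingale.integrable t)
  have hmeas : ∀ t, StronglyMeasurable[filF μ Y hY t] (fun ω => Z t ω i) := fun t =>
    (EuclideanSpace.proj (𝕜 := ℝ) i : Vec d →L[ℝ] ℝ).continuous.comp_stronglyMeasurable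
      (hZ.martingale.stronglyMeasurable t)
  have hFG : filF μ Y hY s ≤ filG μ Y hY ξ hξ s := le_sup_left
  have hset : ∀ A, MeasurableSet[filG μ Y hY ξ hξ s] A →
      ∫ ω in A, Z s ω i ∂μ = ∫ ω in A, Z t ω i ∂μ := by
    intro A hA
    refine setIntegral_eq_of_indep (m₁ := filF μ Y hY s) ((filF μ Y hY).mono hst)
      ((filF μ Y hY).le t) hξ.comap_le (indep_filF h t)
      ((hmeas s).mono ((filF μ Y hY).mono hst)) (hmeas t) (hint s) (hint t) (fun B hB => ?_) hA
    have h1 := hZ.martingale.setIntegral_eq hst hB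
    have h2 : ∀ t, ∫ ω in B, Z t ω i ∂μ = (∫ ω in B, Z t ω ∂μ) i := fun t =>
      (EuclideanSpace.proj (𝕜 := ℝ) i : Vec d →L[ℝ] ℝ).integral_comp_comm
        (hZ.martingale.integrable t).integrableOn
    rw [h2, h2, h1]
  have hce : (fun ω => Z s ω i) =ᵐ[μ] μ[fun ω => Z t ω i | filG μ Y hY ξ hξ s] :=
    ae_eq_condExp_of_forall_setIntegral_eq hle (hint t) (fun _ _ _ => (hint s).integrableOn)
      (fun A hA _ => hset A hA) ((hmeas s).mono hFG).aestronglyMeasurable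
  have hpull := condExp_stronglyMeasurable_mul_of_bound hle (μ := μ) hH.stronglyMeasurable
    (hint t) C (Eventually.of_forall fun ω => (Real.norm_eq_abs _).trans_le (hC ω))
  calc ∫ ω, H ω * Z s ω i ∂μ
      = ∫ ω, (μ[H * fun ω => Z t ω i | filG μ Y hY ξ hξ s]) ω ∂μ := by
        refine integral_congr_ae ?_
        filter_upwards [hce, hpull] with ω h1 h2
        rw [h2, h1, Pi.mul_apply]
    _ = ∫ ω, H ω * Z t ω i ∂μ := integral_condExp hle

end ConicMarket

/-! ### The discrete-time supermartingale inequality -/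

namespace ConicMarket

theorem integrable_sum_mul {Ω ι : Type*} [Fintype ι] [MeasurableSpace Ω] {μ : Measure Ω}
    {z : Ω → ι → ℝ} (hz : ∀ i, Integrable (fun ω => z ω i) μ)
    {H : Ω → ι → ℝ} (hH : ∀ i, Measurable fun ω => H ω i) {C : ℝ} (hC : ∀ ω i, |H ω i| ≤ C) :
    Integrable (fun ω => ∑ i, H ω i * z ω i) μ :=
  integrable_finsetSum _ fun i _ => (hz i).bdd_mul (c := C) (hH i).aestronglyMeasurable
    (Eventually.of_forall fun ω => (Real.norm_eq_abs _).trans_le (hC ω i))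

/-- A discrete-time supermartingale inequality for a portfolio `X`, frozen on leaving the events
`A k` on which it is bounded, under martingale price densities `z` with terminal value `zT`. -/
theorem integral_frozen_le {Ω ι : Type*} [Fintype ι] [mΩ : MeasurableSpace Ω] {μ : Measure Ω}
    {𝓖 : ℕ → MeasurableSpace Ω} (h𝓖 : ∀ k, 𝓖 k ≤ mΩ) (hmono : Monotone 𝓖)
    {z : ℕ → Ω → ι → ℝ} {zT : Ω → ι → ℝ}
    (hzi : ∀ k i, Integrable (fun ω => z k ω i) μ) (hzTi : ∀ i, Integrable (fun ω => zT ω i) μ)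
    (hmart : ∀ k i, ∀ H : Ω → ℝ, Measurable[𝓖 k] H → ∀ C : ℝ, (∀ ω, |H ω| ≤ C) →
      ∫ ω, H ω * z k ω i ∂μ = ∫ ω, H ω * zT ω i ∂μ)
    {X : ℕ → Ω → ι → ℝ} (hX : ∀ k i, Measurable[𝓖 k] fun ω => X k ω i)
    {A : ℕ → Set Ω} (hA : ∀ k, MeasurableSet[𝓖 k] (A k)) (hAanti : Antitone A) {N : ℝ}
    (hXN : ∀ k, ∀ ω ∈ A k, ∀ i, |X k ω i| ≤ N)
    {η : ℕ → Ω → ℝ} (hη : ∀ k, Measurable[𝓖 k] (η k)) (hη0 : ∀ k ω, 0 ≤ η k ω)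
    (hηN : ∀ k ω, η k ω ≤ N)
    (hzT0 : ∀ ω i, 0 ≤ zT ω i) (x : ι → ℝ)
    (hinit : ∀ᵐ ω ∂μ, ∑ i, (X 0 ω i - x i) * z 0 ω i ≤ 0)
    (hdec : ∀ k, ∀ᵐ ω ∂μ, ∑ i, (X (k + 1) ω i - X k ω i) * z (k + 1) ω i ≤ 0)
    (hlow : ∀ k, ∀ᵐ ω ∂μ, ω ∈ A k →
      -(∑ i, η (k + 1) ω * z (k + 1) ω i) ≤ ∑ i, X k ω i * z (k + 1) ω i) (k : ℕ) :
    ∫ ω, ∑ i, (A k).indicator (fun ω => X k ω i) ω * zT ω i ∂μ ≤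
      ∫ ω, ∑ i, |x i| * zT ω i ∂μ +
      ∫ ω, ∑ i, (∑ j ∈ Finset.range k, (A j \ A (j + 1)).indicator (η (j + 1)) ω) * zT ω i ∂μ := by
  -- Every comparison is made pointwise under the density `z k` and then moved to the common density
  -- `zT`.
  have hswap : ∀ k, ∀ H : Ω → ι → ℝ, (∀ i, Measurable[𝓖 k] fun ω => H ω i) → ∀ C : ℝ,
      (∀ ω i, |H ω i| ≤ C) →
      ∫ ω, ∑ i, H ω i * z k ω i ∂μ = ∫ ω, ∑ i, H ω i * zT ω i ∂μ := by
    intro k H hH C hC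
    have hint : ∀ z : Ω → ι → ℝ, (∀ i, Integrable (fun ω => z ω i) μ) → ∀ i,
        Integrable (fun ω => H ω i * z ω i) μ := fun z hz i =>
      (hz i).bdd_mul (c := C) ((hH i).mono (h𝓖 k) le_rfl).aestronglyMeasurable
        (Eventually.of_forall fun ω => (Real.norm_eq_abs _).trans_le (hC ω i))
    rw [integral_finsetSum _ fun i _ => hint _ (hzi k) i,
      integral_finsetSum _ fun i _ => hint _ hzTi i]
    exact Finset.sum_congr rfl fun i _ => hmart k i _ (hH i) C fun ω => hC ω i
  have hW : ∀ k i, Measurable[𝓖 k] ((A k).indicator fun ω => X k ω i) := fun k i =>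
    (hX k i).indicator (hA k)
  have hWN : ∀ k ω i, |(A k).indicator (fun ω => X k ω i) ω| ≤ |N| := fun k ω i => by
    by_cases h : ω ∈ A k
    · simpa [h] using (hXN k ω h i).trans (le_abs_self N)
    · simp [h]
  have hD : ∀ k, Measurable[𝓖 (k + 1)] ((A k \ A (k + 1)).indicator (η (k + 1))) := fun k =>
    (hη (k + 1)).indicator
      (@MeasurableSet.diff _ (𝓖 (k + 1)) _ _ (hmono (Nat.le_succ k) _ (hA k)) (hA (k + 1)))
  have hDN : ∀ k ω, |(A k \ A (k + 1)).indicator (η (k + 1)) ω| ≤ |N| := fun k ω => by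
    by_cases h : ω ∈ A k \ A (k + 1)
    · rw [indicator_of_mem h, abs_of_nonneg (hη0 _ _)]
      exact (hηN _ _).trans (le_abs_self N)
    · simp [h]
  have hstep : ∀ k, ∫ ω, ∑ i, (A (k + 1)).indicator (fun ω => X (k + 1) ω i) ω * zT ω i ∂μ ≤
      ∫ ω, ∑ i, (A k).indicator (fun ω => X k ω i) ω * zT ω i ∂μ +
      ∫ ω, ∑ i, (A k \ A (k + 1)).indicator (η (k + 1)) ω * zT ω i ∂μ := by
    intro k
    have hWk : ∀ i, Measurable[𝓖 (k + 1)] ((A k).indicator fun ω => X k ω i) := fun i =>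
      (hW k i).mono (hmono (Nat.le_succ k)) le_rfl
    rw [← hswap (k + 1) _ (hW (k + 1)) |N| (hWN (k + 1)), ← hswap (k + 1) _ hWk |N| (hWN k),
      ← hswap (k + 1) (fun ω _ => (A k \ A (k + 1)).indicator (η (k + 1)) ω) (fun _ => hD k) |N|
        (fun ω _ => hDN k ω)]
    have hi1 := integrable_sum_mul (hzi (k + 1)) (fun i => (hW (k + 1) i).mono (h𝓖 _) le_rfl)
      (hWN (k + 1))
    have hi2 := integrable_sum_mul (hzi (k + 1)) (fun i => (hW k i).mono (h𝓖 _) le_rfl) (hWN k)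
    have hi3 := integrable_sum_mul (hzi (k + 1))
      (H := fun ω _ => (A k \ A (k + 1)).indicator (η (k + 1)) ω)
      (fun i => (hD k).mono (h𝓖 _) le_rfl) (fun ω _ => hDN k ω)
    rw [← integral_add hi2 hi3]
    refine integral_mono_ae hi1 (hi2.add hi3) ?_
    filter_upwards [hdec k, hlow k] with ω h1 h2
    -- Still bounded: only a trade of nonpositive value occurs. Leaving now: `X k` is dropped before
    -- `X (k + 1)` is formed, at a cost of at most `η (k + 1)`. Already out: all terms vanish.
    by_cases hk1 : ω ∈ A (k + 1)
    · have hk : ω ∈ A k := hAanti (Nat.le_succ k) hk1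
      simp only [sub_mul, Finset.sum_sub_distrib] at h1
      simp only [hk, hk1, indicator_of_mem, Set.mem_sdiff, not_true_eq_false, and_false,
        not_false_eq_true, indicator_of_notMem, zero_mul, Finset.sum_const_zero, add_zero]
      linarith
    · by_cases hk : ω ∈ A k
      · have := h2 hk
        simp only [hk, hk1, indicator_of_mem, Set.mem_sdiff, and_true,
          not_false_eq_true, indicator_of_notMem, zero_mul, Finset.sum_const_zero]
        linarith
      · simp [hk, hk1]
  have hxC : ∀ i, |x i| ≤ ∑ j, |x j| := fun i =>
    Finset.single_le_sum (f := fun j => |x j|) (fun j _ => abs_nonneg _) (Finset.mem_univ i)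
  have hstart : ∫ ω, ∑ i, (A 0).indicator (fun ω => X 0 ω i) ω * zT ω i ∂μ ≤
      ∫ ω, ∑ i, |x i| * zT ω i ∂μ := by
    have hx : ∀ i, Measurable[𝓖 0] ((A 0).indicator fun _ : Ω => x i) := fun i =>
      (@measurable_const _ _ _ (𝓖 0) (x i)).indicator (hA 0)
    have hxb : ∀ ω i, |(A 0).indicator (fun _ : Ω => x i) ω| ≤ ∑ j, |x j| := fun ω i => by
      by_cases h : ω ∈ A 0
      · simpa [h] using hxC i
      · simpa [h] using Finset.sum_nonneg fun j _ => abs_nonneg (x j)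
    have hi1 := integrable_sum_mul (hzi 0) (fun i => (hW 0 i).mono (h𝓖 _) le_rfl) (hWN 0)
    have hi2 := integrable_sum_mul (H := fun ω i => (A 0).indicator (fun _ : Ω => x i) ω) (hzi 0)
      (fun i => (hx i).mono (h𝓖 _) le_rfl) hxb
    have hi3 := integrable_sum_mul (H := fun ω i => (A 0).indicator (fun _ : Ω => x i) ω) hzTi
      (fun i => (hx i).mono (h𝓖 _) le_rfl) hxb
    have hi4 := integrable_sum_mul (H := fun _ i => |x i|) hzTi
      (fun i => measurable_const) (fun ω i => (abs_abs (x i)).trans_le (hxC i))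
    calc _ = ∫ ω, ∑ i, (A 0).indicator (fun ω => X 0 ω i) ω * z 0 ω i ∂μ :=
          (hswap 0 _ (hW 0) |N| (hWN 0)).symm
      _ ≤ ∫ ω, ∑ i, (A 0).indicator (fun _ : Ω => x i) ω * z 0 ω i ∂μ := by
          refine integral_mono_ae hi1 hi2 ?_
          filter_upwards [hinit] with ω h
          by_cases h0 : ω ∈ A 0
          · simp only [sub_mul, Finset.sum_sub_distrib] at h
            simp only [h0, indicator_of_mem]
            linarith
          · simp [h0]
      _ = ∫ ω, ∑ i, (A 0).indicator (fun _ : Ω => x i) ω * zT ω i ∂μ := hswap 0 _ hx _ hxb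
      -- The endowment is lost if `A 0` fails, and coordinates of `x` may be negative; passing to
      -- `|x i|` covers both, as `zT ≥ 0`.
      _ ≤ _ := by
          refine integral_mono hi3 hi4 fun ω => Finset.sum_le_sum fun i _ =>
            mul_le_mul_of_nonneg_right ?_ (hzT0 ω i)
          by_cases h0 : ω ∈ A 0
          · simpa [h0] using le_abs_self (x i)
          · simp [h0]
  induction k with
  | zero => simpa using hstart
  | succ k ih =>
    have hi3 := integrable_sum_mul hzTi
      (H := fun ω _ => (A k \ A (k + 1)).indicator (η (k + 1)) ω)
      (fun i => (hD k).mono (h𝓖 _) le_rfl) (fun ω _ => hDN k ω)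
    have hi4 := integrable_sum_mul hzTi (C := ∑ j ∈ Finset.range k, |N|)
      (H := fun ω _ => ∑ j ∈ Finset.range k, (A j \ A (j + 1)).indicator (η (j + 1)) ω)
      (fun i => Finset.measurable_sum _ fun j _ => (hD j).mono (h𝓖 _) le_rfl)
      (fun ω _ => (Finset.abs_sum_le_sum_abs _ _).trans (Finset.sum_le_sum fun j _ => hDN j ω))
    have hadd := integral_add hi4 hi3
    have hrw : ∀ ω, ∑ i, (∑ j ∈ Finset.range (k + 1),
        (A j \ A (j + 1)).indicator (η (j + 1)) ω) * zT ω i =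
        ∑ i, (∑ j ∈ Finset.range k, (A j \ A (j + 1)).indicator (η (j + 1)) ω) * zT ω i +
          ∑ i, (A k \ A (k + 1)).indicator (η (k + 1)) ω * zT ω i := fun ω => by
      simp only [Finset.sum_range_succ, add_mul, Finset.sum_add_distrib]
    rw [integral_congr_ae (Eventually.of_forall hrw), hadd]
    linarith [hstep k]

/-- Since at most one of the events `A j \ A (j + 1)` occurs, the freezing error is at most the
largest of the local errors. -/
theorem sum_indicator_sdiff_le {Ω : Type*} {A : ℕ → Set Ω} (hA : Antitone A) {η : ℕ → Ω → ℝ}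
    {ω : Ω} {c : ℝ} (hc : 0 ≤ c) (n : ℕ) (hη : ∀ j < n, η (j + 1) ω ≤ c) :
    ∑ j ∈ Finset.range n, (A j \ A (j + 1)).indicator (η (j + 1)) ω ≤ c := by
  by_cases h : ∃ j ∈ Finset.range n, ω ∈ A j \ A (j + 1)
  · obtain ⟨j, hj, hjA⟩ := h
    rw [Finset.sum_eq_single_of_mem j hj, indicator_of_mem hjA]
    · exact hη j (Finset.mem_range.1 hj)
    · intro i _ hij
      refine indicator_of_notMem (fun hi => ?_) _
      rcases lt_or_gt_of_ne hij with h1 | h1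
      · exact hi.2 (hA (Nat.succ_le_of_lt h1) hjA.1)
      · exact hjA.2 (hA (Nat.succ_le_of_lt h1) hi.1)
  · push Not at h
    rw [Finset.sum_eq_zero fun j hj => indicator_of_notMem (h j hj) _]
    exact hc

end ConicMarket

/-! ### Shortfall from solvency and the discretised portfolio -/

namespace ConicMarket

open scoped InnerProductSpace

/-- The pairing of a portfolio with a density is the pairing of the rescaled vectors. -/
theorem inner_hdiv {d : ℕ} (v z s : Vec d) : ⟪v, hdiv z s⟫_ℝ = ∑ i, v i * (z i / s i) := by
  simp only [PiLp.inner_apply, hdiv, RCLike.inner_apply, conj_trivial]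
  exact Finset.sum_congr rfl fun i _ => mul_comm _ _

theorem sum_div_mul_nonpos {d : ℕ} {K : ProperCone ℝ (Vec d)} {z s v : Vec d}
    (hz : hdiv z s ∈ ProperCone.innerDual (K : Set (Vec d))) (hv : -v ∈ K) :
    ∑ i, (1 / s i * v i) * z i ≤ 0 := by
  have h := hz hv
  simp only [innerₗ_apply_apply, inner_neg_left, inner_hdiv] at h
  have : ∑ i, (1 / s i * v i) * z i = ∑ i, v i * (z i / s i) :=
    Finset.sum_congr rfl fun i _ => by ring
  linarith

/-- The shortfall of a portfolio `X` (in physical units) from solvency at prices `s`. -/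
def shortfall {d : ℕ} (K : ProperCone ℝ (Vec d)) (s X : Vec d) : ℝ :=
  Metric.infDist (hmul s X) (K : Set (Vec d)) * ∑ j, 1 / s j

theorem shortfall_nonneg {d : ℕ} (K : ProperCone ℝ (Vec d)) {s : Vec d} (X : Vec d)
    (hs : ∀ i, 0 < s i) : 0 ≤ shortfall K s X :=
  mul_nonneg Metric.infDist_nonneg
    (Finset.sum_nonneg fun j _ => one_div_nonneg.2 (hs j).le)

/-- Replace `hmul s X` by its nearest point in `K`, whose pairing with `z / s` is nonnegative. Each
coordinate changes by at most the distance to `K`, and dividing by `s i` costs at most `∑ j, 1 / s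
j`. -/
theorem neg_shortfall_le {d : ℕ} {K : ProperCone ℝ (Vec d)} {z s X : Vec d}
    (hz0 : ∀ i, 0 ≤ z i) (hs : ∀ i, 0 < s i)
    (hz : hdiv z s ∈ ProperCone.innerDual (K : Set (Vec d))) :
    -(∑ i, shortfall K s X * z i) ≤ ∑ i, X i * z i := by
  obtain ⟨v, hv, hdist⟩ := K.isClosed.exists_infDist_eq_dist ⟨0, K.zero_mem⟩ (hmul s X)
  have h := hz hv
  simp only [innerₗ_apply_apply, inner_hdiv] at h
  have h1 : ∑ i, X i * z i = ∑ i, v i * (z i / s i) + ∑ i, (hmul s X - v) i * (z i / s i) := by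
    rw [← Finset.sum_add_distrib]
    refine Finset.sum_congr rfl fun i _ => ?_
    have := (hs i).ne'
    simp only [hmul, PiLp.sub_apply]
    field_simp
    ring
  rw [h1, ← Finset.sum_neg_distrib]
  refine le_trans (Finset.sum_le_sum fun i _ => ?_) (le_add_of_nonneg_left h)
  have h2 : |(hmul s X - v) i| ≤ Metric.infDist (hmul s X) (K : Set (Vec d)) := by
    rw [hdist, dist_eq_norm]
    simpa using PiLp.norm_apply_le (hmul s X - v) i
  have h3 : 1 / s i ≤ ∑ j, 1 / s j :=
    Finset.single_le_sum (f := fun j => 1 / s j) (fun j _ => one_div_nonneg.2 (hs j).le)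
      (Finset.mem_univ i)
  have h4 : |(hmul s X - v) i| * (1 / s i) ≤ shortfall K s X :=
    mul_le_mul h2 h3 (one_div_nonneg.2 (hs i).le) Metric.infDist_nonneg
  have h5 := neg_abs_le ((hmul s X - v) i)
  have h6 : 0 ≤ z i / s i := div_nonneg (hz0 i) (hs i).le
  calc -(shortfall K s X * z i) ≤ -(|(hmul s X - v) i| * (1 / s i) * z i) :=
        neg_le_neg (mul_le_mul_of_nonneg_right h4 (hz0 i))
    _ = -|(hmul s X - v) i| * (z i / s i) := by ring
    _ ≤ _ := mul_le_mul_of_nonneg_right h5 h6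

theorem measurable_shortfall {Ω : Type*} {mΩ : MeasurableSpace Ω} {d : ℕ} (K : ProperCone ℝ (Vec d))
    {s X : Ω → Vec d} (hs : ∀ i, Measurable fun ω => s ω i) (hX : ∀ i, Measurable fun ω => X ω i) :
    Measurable fun ω => shortfall K (s ω) (X ω) := by
  refine Measurable.mul ?_ (Finset.measurable_sum _ fun j _ => (hs j).const_div 1)
  refine (Metric.continuous_infDist_pt _).measurable.comp ?_
  exact (WithLp.measurable_toLp 2 _).comp (measurable_pi_lambda _ fun i => (hs i).mul (hX i))

/-- The discretised portfolio in physical units. -/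
def discretePortfolio {Ω : Type*} {T : ℝ} [Fact (0 < T)] {d : ℕ} (S : Time T → Ω → Vec d)
    (x : Vec d) (B : Time T → Ω → Vec d) (n k : ℕ) (ω : Ω) : Vec d :=
  WithLp.toLp 2 fun i =>
    x i + riemannSum (fun s => 1 / S s ω i) (fun s => B s ω i) (grid T n) k

section Paths

variable {Ω : Type*} [mΩ : MeasurableSpace Ω] {T : ℝ} [Fact (0 < T)] {d : ℕ}
  {𝓕 𝓖 : Filtration (Time T) mΩ} {S : Time T → Ω → Vec d} {K : ProperCone ℝ (Vec d)}
  {B : Time T → Ω → Vec d} {μ : Measure Ω}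

theorem IsStrategy.boundedVariationOn (hK : IsSolvencyCone K) (hB : IsStrategy 𝓖 K B) (ω : Ω)
    (i : Fin d) : BoundedVariationOn (fun t => B t ω i) univ :=
  (hB.decreasing ω).boundedVariationOn hK i

theorem IsStrategy.rightContinuous (hB : IsStrategy 𝓖 K B) (ω : Ω) (i : Fin d) (t : Time T) :
    ContinuousWithinAt (fun t => B t ω i) (Ici t) t :=
  (EuclideanSpace.proj (𝕜 := ℝ) i : Vec d →L[ℝ] ℝ).continuous.continuousAt.comp_continuousWithinAt
    ((hB.cadlag ω).1 t)

/-- Right tags do not break adaptedness: step `k` involves only times up to `grid T n k`. -/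
theorem measurable_discretePortfolio
    (hS : ∀ t, Measurable[𝓖 t] (S t)) (hB : ∀ t, Measurable[𝓖 t] (B t)) (x : Vec d) (n k : ℕ)
    (i : Fin d) : Measurable[𝓖 (grid T n k)] fun ω => discretePortfolio S x B n k ω i := by
  have hco : ∀ (X : Time T → Ω → Vec d), (∀ t, Measurable[𝓖 t] (X t)) → ∀ t, t ≤ grid T n k →
      Measurable[𝓖 (grid T n k)] fun ω => X t ω i := fun X hX t ht =>
    (EuclideanSpace.proj (𝕜 := ℝ) i : Vec d →L[ℝ] ℝ).continuous.measurable.comp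
      ((hX t).mono (𝓖.mono ht) le_rfl)
  have h0 : timeZero T ≤ grid T n k := (grid_zero T n) ▸ grid_monotone T n (Nat.zero_le k)
  simp only [discretePortfolio, riemannSum]
  refine measurable_const.add (Measurable.add ?_ (Finset.measurable_sum _ fun j hj => ?_))
  · exact ((hco S hS _ h0).const_div 1).mul (hco B hB _ h0)
  · have h1 : grid T n (j + 1) ≤ grid T n k := grid_monotone T n (Finset.mem_range.1 hj)
    have h2 : grid T n j ≤ grid T n k := grid_monotone T n (Finset.mem_range.1 hj).le
    exact ((hco S hS _ h1).const_div 1).mul ((hco B hB _ h1).sub (hco B hB _ h2))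

variable [NeZero d]

theorem IsPriceProcess.continuous_coord (hS : IsPriceProcess 𝓕 S) (ω : Ω) (i : Fin d) :
    Continuous fun t => S t ω i :=
  (EuclideanSpace.proj (𝕜 := ℝ) i : Vec d →L[ℝ] ℝ).continuous.comp (hS.continuous ω)

theorem IsPriceProcess.continuous_inv (hS : IsPriceProcess 𝓕 S) (ω : Ω) (i : Fin d) :
    Continuous fun t => 1 / S t ω i :=
  continuous_const.div (hS.continuous_coord ω i) fun t => (hS.pos t ω i).ne'

theorem eventually_abs_physicalValue_sub_lt (hS : IsPriceProcess 𝓕 S) (hK : IsSolvencyCone K)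
    (hB : IsStrategy 𝓖 K B) (x : Vec d) (ω : Ω) {ε : ℝ} (hε : 0 < ε) :
    ∀ᶠ n in atTop, ∀ i k,
      |physicalValue S x B (grid T n k) ω i - discretePortfolio S x B n k ω i| < ε := by
  refine eventually_all.2 fun i => ?_
  filter_upwards [eventually_abs_stieltjesIntegral_sub_riemannSum_lt (hS.continuous_inv ω i)
    (hB.boundedVariationOn hK ω i) (hB.rightContinuous ω i) hε] with n hn k
  simpa [physicalValue, discretePortfolio] using hn k

theorem exists_abs_physicalValue_le (hS : IsPriceProcess 𝓕 S) (hK : IsSolvencyCone K)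
    (hB : IsStrategy 𝓖 K B) (x : Vec d) (ω : Ω) :
    ∃ L, ∀ t i, |physicalValue S x B t ω i| ≤ L := by
  choose C hC using fun i => exists_abs_stieltjesIntegral_le (hS.continuous_inv ω i)
    (hB.boundedVariationOn hK ω i)
  refine ⟨∑ i, (|x i| + C i), fun t i => ?_⟩
  refine le_trans ?_ (Finset.single_le_sum (f := fun i => |x i| + C i) (fun j _ =>
    add_nonneg (abs_nonneg _) ((abs_nonneg _).trans (hC j t))) (Finset.mem_univ i))
  exact (abs_add_le _ _).trans (add_le_add le_rfl (hC i t))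

theorem tendsto_discretePortfolio (hS : IsPriceProcess 𝓕 S) (hK : IsSolvencyCone K)
    (hB : IsStrategy 𝓖 K B) (x : Vec d) (ω : Ω) (i : Fin d) :
    Tendsto (fun n => discretePortfolio S x B n n ω i) atTop
      (𝓝 (physicalValue S x B (timeEnd T) ω i)) := by
  refine Metric.tendsto_nhds.2 fun ε hε => ?_
  filter_upwards [eventually_abs_physicalValue_sub_lt hS hK hB x ω hε, eventually_gt_atTop 0]
    with n hn h0
  have := hn i n
  rwa [grid_of_le T h0 le_rfl, abs_sub_comm] at this

theorem measurable_physicalValue (hS : IsPriceProcess 𝓕 S) (hK : IsSolvencyCone K)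
    (hB : IsStrategy 𝓖 K B) (h𝓕𝓖 : 𝓕 ≤ 𝓖) (x : Vec d) :
    Measurable (physicalValue S x B (timeEnd T)) := by
  have : ∀ i, Measurable fun ω => physicalValue S x B (timeEnd T) ω i := fun i =>
    measurable_of_tendsto_metrizable (fun n =>
      (measurable_discretePortfolio (fun t => (hS.adapted t).mono (h𝓕𝓖 t) le_rfl) hB.adapted x n n
        i).mono (𝓖.le _) le_rfl)
      (tendsto_pi_nhds.2 fun ω => tendsto_discretePortfolio hS hK hB x ω i)
  exact (WithLp.measurable_toLp 2 _).comp (measurable_pi_lambda _ this)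

/-- Along admissible paths the discretised portfolios are asymptotically solvent, uniformly in
time. -/
theorem eventually_shortfall_lt (hS : IsPriceProcess 𝓕 S) (hK : IsSolvencyCone K)
    (hB : IsStrategy 𝓖 K B) (x : Vec d) {ω : Ω}
    (hadm : ∀ n k, portfolioValue S x B (grid T n k) ω ∈ K) {ε : ℝ} (hε : 0 < ε) :
    ∀ᶠ n in atTop, ∀ k,
      shortfall K (S (grid T n (k + 1)) ω) (discretePortfolio S x B n k ω) < ε := by
  obtain ⟨L, hL⟩ := exists_abs_physicalValue_le hS hK hB x ω
  obtain ⟨M, hM⟩ := isCompact_univ.exists_bound_of_continuousOn (hS.continuous ω).continuousOn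
  have hQc : Continuous fun t => ∑ j, 1 / S t ω j :=
    continuous_finsetSum _ fun j _ => hS.continuous_inv ω j
  obtain ⟨Q, hQ⟩ := isCompact_univ.exists_bound_of_continuousOn hQc.continuousOn
  have hL0 : 0 ≤ L := (abs_nonneg _).trans (hL (timeZero T) 0)
  have hM0 : 0 ≤ M := (norm_nonneg _).trans (hM (timeZero T) (mem_univ _))
  have hQ0 : 0 ≤ Q := (norm_nonneg _).trans (hQ (timeZero T) (mem_univ _))
  -- The estimates below bound the shortfall by `δ * (R - 1)`; the added `1` makes `R` positive and
  -- the final inequality strict.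
  set R : ℝ := (d : ℝ) * (L + 1 + M) * Q + 1
  have hR : 0 < R := by positivity
  set δ : ℝ := min 1 (ε / R)
  have hδ : 0 < δ := lt_min one_pos (by positivity)
  filter_upwards [eventually_abs_physicalValue_sub_lt hS hK hB x ω hδ,
    eventually_dist_grid_lt (hS.continuous ω) hδ] with n h1 h2 k
  set X := discretePortfolio S x B n k ω
  set V := physicalValue S x B (grid T n k) ω
  set s := S (grid T n k) ω
  set s' := S (grid T n (k + 1)) ω
  have hcoord : ∀ i, ‖(hmul s' X - hmul s V) i‖ ≤ δ * (L + 1 + M) := fun i => by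
    have e1 : |V i - X i| < δ := h1 i k
    have e2 : |s' i - s i| ≤ δ := by
      have := (PiLp.norm_apply_le (s' - s) i).trans_lt
        ((dist_eq_norm s' s) ▸ dist_comm s s' ▸ h2 k _ ⟨le_rfl, grid_monotone T n (Nat.le_succ k)⟩)
      exact this.le
    have e3 : |s i| ≤ M := (PiLp.norm_apply_le s i).trans (hM _ (mem_univ _))
    have e4 : |X i| ≤ L + 1 := by
      have h3 := hL (grid T n k) i
      have h4 : δ ≤ 1 := min_le_left _ _
      have h5 : |X i| ≤ |V i| + |V i - X i| := by
        have := abs_sub_abs_le_abs_sub (X i) (V i)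
        rw [abs_sub_comm] at this
        linarith
      have h6 : |V i| ≤ L := h3
      linarith
    -- Two errors: the price moves over one cell, and the Riemann sum differs from the integral.
    -- `hmul s V` itself is solvent by admissibility.
    have : (hmul s' X - hmul s V) i = (s' i - s i) * X i + s i * (X i - V i) := by
      simp only [hmul, PiLp.sub_apply]; ring
    rw [this, Real.norm_eq_abs]
    refine (abs_add_le _ _).trans ?_
    rw [abs_mul, abs_mul, abs_sub_comm (X i)]
    have e5 := mul_le_mul e2 e4 (abs_nonneg _) hδ.le
    have e6 := mul_le_mul e3 e1.le (abs_nonneg _) hM0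
    linarith
  have hdist : Metric.infDist (hmul s' X) (K : Set (Vec d)) ≤ d * (δ * (L + 1 + M)) := by
    refine (Metric.infDist_le_dist_of_mem (hadm n k)).trans ?_
    rw [dist_eq_norm]
    have h0 : 0 ≤ d * (δ * (L + 1 + M)) := by positivity
    rw [EuclideanSpace.norm_eq, Real.sqrt_le_left h0]
    calc ∑ i, ‖(hmul s' X - hmul s V) i‖ ^ 2 ≤ (∑ i, ‖(hmul s' X - hmul s V) i‖) ^ 2 :=
          Finset.sum_sq_le_sq_sum_of_nonneg fun i _ => norm_nonneg _
      _ ≤ (∑ _i : Fin d, δ * (L + 1 + M)) ^ 2 :=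
          pow_le_pow_left₀ (Finset.sum_nonneg fun i _ => norm_nonneg _)
            (Finset.sum_le_sum fun i _ => hcoord i) 2
      _ = _ := by simp
  have hQ' : ∑ j, 1 / s' j ≤ Q := (le_abs_self _).trans (hQ _ (mem_univ _))
  have hpos : 0 ≤ ∑ j, 1 / s' j := Finset.sum_nonneg fun j _ =>
    one_div_nonneg.2 (hS.pos _ ω j).le
  have hδR : δ * R ≤ ε := by
    have := min_le_right 1 (ε / R)
    calc δ * R ≤ ε / R * R := mul_le_mul_of_nonneg_right this hR.le
      _ = ε := div_mul_cancel₀ _ hR.ne'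
  calc shortfall K s' X ≤ d * (δ * (L + 1 + M)) * Q :=
        mul_le_mul hdist hQ' hpos (by positivity)
    _ = δ * (R - 1) := by simp only [R]; ring
    _ < ε := by linarith

end Paths

end ConicMarket

/-! ### Freezing the discretised portfolio, and the budget inequality on the grid -/

namespace ConicMarket

section Discretisation

variable {Ω : Type*} {T : ℝ} [Fact (0 < T)] {d : ℕ}

/-- The event that the discretised portfolio has stayed below `N` up to step `k`. -/
def boundedEvent (S : Time T → Ω → Vec d) (x : Vec d) (B : Time T → Ω → Vec d) (N : ℕ)
    (n k : ℕ) : Set Ω :=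
  ⋂ j, ⋂ (_ : j ≤ k), ⋂ i, {ω | |discretePortfolio S x B n j ω i| ≤ N}

/-- The shortfall at step `k` of the portfolio held since step `k - 1`, truncated at `N`. -/
def localError (K : ProperCone ℝ (Vec d)) (S : Time T → Ω → Vec d) (x : Vec d)
    (B : Time T → Ω → Vec d) (N : ℕ) (n k : ℕ) (ω : Ω) : ℝ :=
  min N (shortfall K (S (grid T n k) ω) (discretePortfolio S x B n (k - 1) ω))

/-- The total error of the portfolio frozen on leaving `boundedEvent`. -/
def freezingError (K : ProperCone ℝ (Vec d)) (S : Time T → Ω → Vec d) (x : Vec d)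
    (B : Time T → Ω → Vec d) (N : ℕ) (n : ℕ) (ω : Ω) : ℝ :=
  ∑ j ∈ Finset.range n, (boundedEvent S x B N n j \ boundedEvent S x B N n (j + 1)).indicator
    (localError K S x B N n (j + 1)) ω

/-- The terminal frozen portfolio, topped up by the last local error. -/
def frozenPortfolio (K : ProperCone ℝ (Vec d)) (S : Time T → Ω → Vec d) (x : Vec d)
    (B : Time T → Ω → Vec d) (N : ℕ) (n : ℕ) (ω : Ω) (i : Fin d) : ℝ :=
  (boundedEvent S x B N n n).indicator (fun ω => discretePortfolio S x B n n ω i) ω +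
    localError K S x B N n (n + 1) ω

variable {S : Time T → Ω → Vec d} {K : ProperCone ℝ (Vec d)} {B : Time T → Ω → Vec d}
  {x : Vec d}

theorem antitone_boundedEvent (N n : ℕ) : Antitone (boundedEvent S x B N n) := fun _ _ hkl _ hω =>
  mem_iInter₂.2 fun j hj => mem_iInter₂.1 hω j (hj.trans hkl)

theorem abs_le_of_mem_boundedEvent {N n k : ℕ} {ω : Ω} (h : ω ∈ boundedEvent S x B N n k)
    (i : Fin d) : |discretePortfolio S x B n k ω i| ≤ N :=
  mem_iInter.1 (mem_iInter₂.1 h k le_rfl) i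

theorem localError_le (N n k : ℕ) (ω : Ω) : localError K S x B N n k ω ≤ N := min_le_left _ _

theorem localError_nonneg (hpos : ∀ t ω i, 0 < S t ω i) (N n k : ℕ) (ω : Ω) :
    0 ≤ localError K S x B N n k ω :=
  le_min (Nat.cast_nonneg N) (shortfall_nonneg K _ (hpos _ ω))

theorem freezingError_le (N n : ℕ) {ω : Ω} {c : ℝ} (hc : 0 ≤ c)
    (h : ∀ k, localError K S x B N n (k + 1) ω ≤ c) : freezingError K S x B N n ω ≤ c :=
  sum_indicator_sdiff_le (antitone_boundedEvent N n) hc n fun j _ => h j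

theorem freezingError_nonneg (hpos : ∀ t ω i, 0 < S t ω i) (N n : ℕ) (ω : Ω) :
    0 ≤ freezingError K S x B N n ω :=
  Finset.sum_nonneg fun _ _ => indicator_nonneg (fun ω _ => localError_nonneg hpos N n _ ω) ω

theorem abs_frozen_le (N n k : ℕ) (ω : Ω) (i : Fin d) :
    |(boundedEvent S x B N n k).indicator (fun ω => discretePortfolio S x B n k ω i) ω| ≤ N := by
  by_cases h : ω ∈ boundedEvent S x B N n k
  · simpa [h] using abs_le_of_mem_boundedEvent h i
  · simp [h]

/-- Truncating the shortfall at `N` is harmless: on the bounded event every coordinate is at least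
`-N` anyway. The truncation keeps the error bounded, hence integrable against `Z`. -/
theorem neg_localError_le {N n k : ℕ} {ω : Ω} {z : Vec d} (hpos : ∀ t ω i, 0 < S t ω i)
    (hz0 : ∀ i, 0 ≤ z i)
    (hz : hdiv z (S (grid T n (k + 1)) ω) ∈ ProperCone.innerDual (K : Set (Vec d)))
    (hω : ω ∈ boundedEvent S x B N n k) :
    -(∑ i, localError K S x B N n (k + 1) ω * z i) ≤ ∑ i, discretePortfolio S x B n k ω i * z i := by
  simp only [localError, Nat.add_sub_cancel]
  rcases min_choice (N : ℝ) (shortfall K (S (grid T n (k + 1)) ω) (discretePortfolio S x B n k ω))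
    with h | h
  · rw [h, ← Finset.sum_neg_distrib]
    refine Finset.sum_le_sum fun i _ => ?_
    have := neg_le_of_abs_le (abs_le_of_mem_boundedEvent hω i)
    nlinarith [hz0 i]
  · rw [h]
    exact neg_shortfall_le hz0 (hpos _ ω) hz

variable [mΩ : MeasurableSpace Ω] {𝓖 : Filtration (Time T) mΩ}

theorem measurableSet_boundedEvent (hS : ∀ t, Measurable[𝓖 t] (S t))
    (hB : ∀ t, Measurable[𝓖 t] (B t)) (N n k : ℕ) :
    MeasurableSet[𝓖 (grid T n k)] (boundedEvent S x B N n k) := by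
  refine MeasurableSet.iInter fun j => MeasurableSet.iInter fun hj => MeasurableSet.iInter
    fun i => ?_
  have h := (measurable_discretePortfolio hS hB x n j i).mono
    (𝓖.mono (grid_monotone T n hj)) le_rfl
  exact (measurableSet_Iic (a := (N : ℝ))).preimage (measurable_norm.comp h)

theorem measurable_localError (hS : ∀ t, Measurable[𝓖 t] (S t))
    (hB : ∀ t, Measurable[𝓖 t] (B t)) (N n k : ℕ) :
    Measurable[𝓖 (grid T n k)] (localError K S x B N n k) := by
  refine measurable_const.min (measurable_shortfall K (fun i => ?_) fun i => ?_)
  · exact (EuclideanSpace.proj (𝕜 := ℝ) i : Vec d →L[ℝ] ℝ).continuous.measurable.comp (hS _)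
  · exact (measurable_discretePortfolio hS hB x n (k - 1) i).mono
      (𝓖.mono (grid_monotone T n (Nat.sub_le k 1))) le_rfl

theorem measurable_freezingError (hS : ∀ t, Measurable[𝓖 t] (S t))
    (hB : ∀ t, Measurable[𝓖 t] (B t)) (N n : ℕ) : Measurable (freezingError K S x B N n) :=
  Finset.measurable_sum _ fun j _ =>
    ((measurable_localError hS hB N n (j + 1)).mono (𝓖.le _) le_rfl).indicator
      ((𝓖.le _ _ (measurableSet_boundedEvent hS hB N n j)).diff
        (𝓖.le _ _ (measurableSet_boundedEvent hS hB N n (j + 1))))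

theorem measurable_frozenPortfolio (hS : ∀ t, Measurable[𝓖 t] (S t))
    (hB : ∀ t, Measurable[𝓖 t] (B t)) (N n : ℕ) (i : Fin d) :
    Measurable fun ω => frozenPortfolio K S x B N n ω i :=
  (((measurable_discretePortfolio hS hB x n n i).mono (𝓖.le _) le_rfl).indicator
    (𝓖.le _ _ (measurableSet_boundedEvent hS hB N n n))).add
    ((measurable_localError hS hB N n (n + 1)).mono (𝓖.le _) le_rfl)

end Discretisation

section Supermartingale

variable {Ω : Type*} [mΩ : MeasurableSpace Ω] {μ : Measure Ω} {T : ℝ} {m d : ℕ}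
  {Y : Time T → Ω → Vec m} {hY : ∀ t, StronglyMeasurable (Y t)} {ξ : Ω → ℝ} {hξ : Measurable ξ}
  {S : Time T → Ω → Vec d} {K : ProperCone ℝ (Vec d)} {Z : Time T → Ω → Vec d}
  {x : Vec d} {B : Time T → Ω → Vec d}

theorem filF_le_filG : filF μ Y hY ≤ filG μ Y hY ξ hξ := le_sup_left

theorem IsPriceProcess.measurable_filG [Fact (0 < T)] [NeZero d]
    (hS : IsPriceProcess (filF μ Y hY) S) (t : Time T) :
    Measurable[filG μ Y hY ξ hξ t] (S t) :=
  (hS.adapted t).mono (filF_le_filG t) le_rfl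

theorem IsCPS.integrable_coord (hZ : IsCPS μ (filF μ Y hY) K S Z) (t : Time T) (i : Fin d) :
    Integrable (fun ω => Z t ω i) μ :=
  (EuclideanSpace.proj (𝕜 := ℝ) i : Vec d →L[ℝ] ℝ).integrable_comp (hZ.martingale.integrable t)

theorem IsCPS.measurable_coord (hZ : IsCPS μ (filF μ Y hY) K S Z) (t : Time T) (i : Fin d) :
    Measurable (fun ω => Z t ω i) :=
  (EuclideanSpace.proj (𝕜 := ℝ) i : Vec d →L[ℝ] ℝ).continuous.measurable.comp
    ((hZ.martingale.stronglyMeasurable t).mono ((filF μ Y hY).le t)).measurable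

variable [IsProbabilityMeasure μ] [Fact (0 < T)] [NeZero d]

/-- The local error of index `n + 1` is added on both sides of the frozen inequality: it makes the
left integrand nonnegative, as Fatou's lemma will require. -/
theorem integral_frozenPortfolio_le (h : IsDriving μ Y ξ) (hS : IsPriceProcess (filF μ Y hY) S)
    (hZ : IsCPS μ (filF μ Y hY) K S Z) (hB : IsStrategy (filG μ Y hY ξ hξ) K B) (N n : ℕ) :
    ∫ ω, ∑ i, frozenPortfolio K S x B N n ω i * Z (timeEnd T) ω i ∂μ ≤
      ∫ ω, ∑ i, |x i| * Z (timeEnd T) ω i ∂μ +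
      ∫ ω, ∑ i, (freezingError K S x B N n ω + localError K S x B N n (n + 1) ω) *
        Z (timeEnd T) ω i ∂μ := by
  have hSm := hS.measurable_filG (ξ := ξ) (hξ := hξ)
  have hle : ∀ t, (filG μ Y hY ξ hξ) t ≤ mΩ := (filG μ Y hY ξ hξ).le
  have key := integral_frozen_le (μ := μ) (𝓖 := fun k => filG μ Y hY ξ hξ (grid T n k))
    (fun k => hle _) (fun i j hij => (filG μ Y hY ξ hξ).mono (grid_monotone T n hij))
    (z := fun k ω i => Z (grid T n k) ω i) (zT := fun ω i => Z (timeEnd T) ω i)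
    (fun k i => hZ.integrable_coord _ i) (fun i => hZ.integrable_coord _ i)
    (fun k i H hH C hC => hZ.integral_mul_eq h (grid T n k).2.2 i hH hC)
    (X := fun k ω i => discretePortfolio S x B n k ω i)
    (fun k i => measurable_discretePortfolio hSm hB.adapted x n k i)
    (A := boundedEvent S x B N n) (measurableSet_boundedEvent hSm hB.adapted N n)
    (antitone_boundedEvent N n) (N := N) (fun k ω hω i => abs_le_of_mem_boundedEvent hω i)
    (η := localError K S x B N n) (measurable_localError hSm hB.adapted N n)
    (localError_nonneg hS.pos N n) (localError_le N n)
    (fun ω i => hZ.mem_orthant _ ω i) (fun i => x i) ?_ ?_ ?_ n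
  · have hi1 := integrable_sum_mul (fun i => hZ.integrable_coord (timeEnd T) i)
      (H := fun ω i => (boundedEvent S x B N n n).indicator
        (fun ω => discretePortfolio S x B n n ω i) ω)
      (fun i => ((measurable_discretePortfolio hSm hB.adapted x n n i).mono (hle _)
        le_rfl).indicator (hle _ _ (measurableSet_boundedEvent hSm hB.adapted N n n)))
      (abs_frozen_le N n n)
    have hi2 := integrable_sum_mul (fun i => hZ.integrable_coord (timeEnd T) i)
      (H := fun ω _ => localError K S x B N n (n + 1) ω)
      (fun _ => (measurable_localError hSm hB.adapted N n (n + 1)).mono (hle _) le_rfl)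
      (C := N) (fun ω _ => (abs_of_nonneg (localError_nonneg hS.pos N n _ ω)).trans_le
        (localError_le N n _ ω))
    have hi3 := integrable_sum_mul (fun i => hZ.integrable_coord (timeEnd T) i)
      (H := fun ω _ => freezingError K S x B N n ω)
      (fun _ => measurable_freezingError hSm hB.adapted N n) (C := N)
      (fun ω _ => (abs_of_nonneg (freezingError_nonneg hS.pos N n ω)).trans_le
        (freezingError_le N n (Nat.cast_nonneg N) fun k => localError_le N n _ ω))
    simp only [frozenPortfolio, add_mul, Finset.sum_add_distrib]
    rw [integral_add hi1 hi2, integral_add hi3 hi2]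
    simp only [freezingError] at hi3 ⊢
    linarith
  · filter_upwards [hZ.mem_dual (grid T n 0)] with ω hω
    have h0 := (hB.decreasing ω).initial
    rw [zero_sub, ← grid_zero T n] at h0
    have := sum_div_mul_nonpos hω.1 h0
    simpa [discretePortfolio, riemannSum, grid_zero] using this
  · intro k
    filter_upwards [hZ.mem_dual (grid T n (k + 1))] with ω hω
    have h0 := (hB.decreasing ω).sub_mem _ _ (grid_monotone T n (Nat.le_succ k))
    rw [← neg_sub] at h0
    have := sum_div_mul_nonpos hω.1 h0
    simpa [discretePortfolio, riemannSum, Finset.sum_range_succ, add_sub_add_left_eq_sub] using this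
  · intro k
    filter_upwards [hZ.mem_dual (grid T n (k + 1))] with ω hω hωA
    exact neg_localError_le hS.pos (fun i => hZ.mem_orthant _ ω i) hω.1 hωA

end Supermartingale

end ConicMarket

/-! ### Passage to the limit: the continuous-time budget constraint -/

namespace ConicMarket

section Limit

variable {Ω : Type*} [mΩ : MeasurableSpace Ω] {μ : Measure Ω} {T : ℝ} [Fact (0 < T)] {m d : ℕ}
  {Y : Time T → Ω → Vec m} {hY : ∀ t, StronglyMeasurable (Y t)} {ξ : Ω → ℝ}
  {hξ : Measurable ξ} {S : Time T → Ω → Vec d} {K : ProperCone ℝ (Vec d)} {Z : Time T → Ω → Vec d}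
  {x : Vec d} {B : Time T → Ω → Vec d} {𝓕 𝓖 : Filtration (Time T) mΩ}

/-- Only countably many grid times occur, so a single null set suffices. -/
theorem ae_portfolioValue_grid_mem (hB : B ∈ admissible μ 𝓖 K S x) :
    ∀ᵐ ω ∂μ, ∀ n k, portfolioValue S x B (grid T n k) ω ∈ K :=
  ae_all_iff.2 fun _ => ae_all_iff.2 fun _ => hB.2 _

variable [NeZero d]

theorem eventually_localError_lt (hS : IsPriceProcess 𝓕 S) (hK : IsSolvencyCone K)
    (hB : IsStrategy 𝓖 K B) {ω : Ω} (hadm : ∀ n k, portfolioValue S x B (grid T n k) ω ∈ K)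
    (N : ℕ) {ε : ℝ} (hε : 0 < ε) :
    ∀ᶠ n in atTop, ∀ k, localError K S x B N n (k + 1) ω < ε := by
  filter_upwards [eventually_shortfall_lt hS hK hB x hadm hε] with n hn k
  exact min_lt_of_right_lt (hn k)

theorem tendsto_localError (hS : IsPriceProcess 𝓕 S) (hK : IsSolvencyCone K)
    (hB : IsStrategy 𝓖 K B) {ω : Ω} (hadm : ∀ n k, portfolioValue S x B (grid T n k) ω ∈ K)
    (N : ℕ) : Tendsto (fun n => localError K S x B N n (n + 1) ω) atTop (𝓝 0) := by
  refine Metric.tendsto_nhds.2 fun ε hε => ?_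
  filter_upwards [eventually_localError_lt hS hK hB hadm N hε] with n hn
  rw [Real.dist_0_eq_abs, abs_of_nonneg (localError_nonneg hS.pos N n _ ω)]
  exact hn n

theorem tendsto_freezingError (hS : IsPriceProcess 𝓕 S) (hK : IsSolvencyCone K)
    (hB : IsStrategy 𝓖 K B) {ω : Ω} (hadm : ∀ n k, portfolioValue S x B (grid T n k) ω ∈ K)
    (N : ℕ) : Tendsto (fun n => freezingError K S x B N n ω) atTop (𝓝 0) := by
  refine Metric.tendsto_nhds.2 fun ε hε => ?_
  filter_upwards [eventually_localError_lt hS hK hB hadm N (half_pos hε)] with n hn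
  rw [Real.dist_0_eq_abs, abs_of_nonneg (freezingError_nonneg hS.pos N n ω)]
  exact (freezingError_le N n (half_pos hε).le fun k => (hn k).le).trans_lt (half_lt_self hε)

theorem eventually_mem_boundedEvent (hS : IsPriceProcess 𝓕 S) (hK : IsSolvencyCone K)
    (hB : IsStrategy 𝓖 K B) {ω : Ω} {L : ℝ} (hL : ∀ t i, |physicalValue S x B t ω i| ≤ L) {N : ℕ}
    (hN : L + 1 ≤ N) : ∀ᶠ n in atTop, ω ∈ boundedEvent S x B N n n := by
  filter_upwards [eventually_abs_physicalValue_sub_lt hS hK hB x ω one_pos] with n hn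
  refine mem_iInter₂.2 fun j _ => mem_iInter.2 fun i => ?_
  have h1 := hn i j
  have h2 := hL (grid T n j) i
  have h3 := abs_sub_abs_le_abs_sub (discretePortfolio S x B n j ω i)
    (physicalValue S x B (grid T n j) ω i)
  rw [abs_sub_comm] at h3
  change |discretePortfolio S x B n j ω i| ≤ N
  linarith

theorem tendsto_sum_frozenPortfolio (hS : IsPriceProcess 𝓕 S) (hK : IsSolvencyCone K)
    (hB : IsStrategy 𝓖 K B) {ω : Ω} (hadm : ∀ n k, portfolioValue S x B (grid T n k) ω ∈ K)
    {L : ℝ} (hL : ∀ t i, |physicalValue S x B t ω i| ≤ L) {N : ℕ} (hN : L + 1 ≤ N) (z : Vec d) :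
    Tendsto (fun n => ∑ i, frozenPortfolio K S x B N n ω i * z i) atTop
      (𝓝 (∑ i, physicalValue S x B (timeEnd T) ω i * z i)) := by
  refine tendsto_finsetSum _ fun i _ => Tendsto.mul_const _ ?_
  have h1 := (tendsto_discretePortfolio hS hK hB x ω i).add (tendsto_localError hS hK hB hadm N)
  rw [add_zero] at h1
  refine h1.congr' ?_
  filter_upwards [eventually_mem_boundedEvent hS hK hB hL hN] with n hn
  simp [frozenPortfolio, hn]

theorem tendsto_integral_error (hS : IsPriceProcess (filF μ Y hY) S) (hK : IsSolvencyCone K)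
    (hZ : IsCPS μ (filF μ Y hY) K S Z) (hB : B ∈ admissible μ (filG μ Y hY ξ hξ) K S x) (N : ℕ) :
    Tendsto (fun n => ∫ ω, ∑ i, (freezingError K S x B N n ω + localError K S x B N n (n + 1) ω) *
        Z (timeEnd T) ω i ∂μ) atTop (𝓝 0) := by
  have hSm := hS.measurable_filG (ξ := ξ) (hξ := hξ)
  rw [show (0 : ℝ) = ∫ _, (0 : ℝ) ∂μ by simp]
  refine tendsto_integral_of_dominated_convergence
    (fun ω => ∑ i, (2 * N : ℝ) * Z (timeEnd T) ω i) (fun n => ?_)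
    (integrable_finsetSum _ fun i _ => (hZ.integrable_coord _ i).const_mul _) (fun n => ?_) ?_
  · refine (Finset.measurable_sum _ fun i _ => Measurable.mul ?_
      (hZ.measurable_coord _ i)).aestronglyMeasurable
    exact (measurable_freezingError hSm hB.1.adapted N n).add
      ((measurable_localError hSm hB.1.adapted N n (n + 1)).mono ((filG μ Y hY ξ hξ).le _) le_rfl)
  · refine Eventually.of_forall fun ω => ?_
    have h1 := freezingError_nonneg (K := K) (x := x) (B := B) hS.pos N n ω
    have h2 := localError_nonneg (K := K) (x := x) (B := B) hS.pos N n (n + 1) ω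
    have h3 : freezingError K S x B N n ω ≤ N :=
      freezingError_le N n (Nat.cast_nonneg N) fun k => localError_le N n _ ω
    have h4 : localError K S x B N n (n + 1) ω ≤ N := localError_le N n (n + 1) ω
    rw [Real.norm_eq_abs, abs_of_nonneg (Finset.sum_nonneg fun i _ =>
      mul_nonneg (add_nonneg h1 h2) (hZ.mem_orthant _ ω i))]
    exact Finset.sum_le_sum fun i _ =>
      mul_le_mul_of_nonneg_right (by linarith) (hZ.mem_orthant _ ω i)
  · filter_upwards [ae_portfolioValue_grid_mem hB] with ω hω
    have h1 := (tendsto_freezingError hS hK hB.1 hω N).add (tendsto_localError hS hK hB.1 hω N)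
    have := tendsto_finsetSum Finset.univ fun (i : Fin d) _ =>
      h1.mul_const (Z (timeEnd T) ω i)
    simpa using this

/-- For `n > 0` the grid point of index `n + 1` is still `T`, so the top-up is the truncated
shortfall at `T` of the terminal portfolio itself. -/
theorem sum_frozenPortfolio_nonneg (hS : IsPriceProcess (filF μ Y hY) S)
    (hZ : IsCPS μ (filF μ Y hY) K S Z) (N : ℕ) {n : ℕ} (hn : 0 < n) :
    ∀ᵐ ω ∂μ, 0 ≤ ∑ i, frozenPortfolio K S x B N n ω i * Z (timeEnd T) ω i := by
  filter_upwards [hZ.mem_dual (timeEnd T)] with ω hω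
  have h0 := hZ.mem_orthant (timeEnd T) ω
  simp only [frozenPortfolio, add_mul, Finset.sum_add_distrib]
  by_cases hA : ω ∈ boundedEvent S x B N n n
  · have := neg_localError_le hS.pos h0 (by rw [grid_of_le T hn (Nat.le_succ n)]; exact hω.1) hA
    simp only [hA, indicator_of_mem]
    linarith
  · simp only [hA, not_false_eq_true, indicator_of_notMem, zero_mul, Finset.sum_const_zero,
      zero_add]
    exact Finset.sum_nonneg fun i _ => mul_nonneg (localError_nonneg hS.pos N n _ ω) (h0 i)

/-- The budget constraint: the value of a terminal admissible portfolio under a consistent price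
system is bounded independently of the strategy. -/
theorem lintegral_physicalValue_le [IsProbabilityMeasure μ] (h : IsDriving μ Y ξ) (hS : IsPriceProcess (filF μ Y hY) S)
    (hK : IsSolvencyCone K) (hZ : IsCPS μ (filF μ Y hY) K S Z)
    (hB : B ∈ admissible μ (filG μ Y hY ξ hξ) K S x) :
    ∫⁻ ω, ENNReal.ofReal (∑ i, physicalValue S x B (timeEnd T) ω i * Z (timeEnd T) ω i) ∂μ ≤
      ENNReal.ofReal (∫ ω, ∑ i, |x i| * Z (timeEnd T) ω i ∂μ) := by
  have hSm := hS.measurable_filG (ξ := ξ) (hξ := hξ)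
  set c : ℝ := ∫ ω, ∑ i, |x i| * Z (timeEnd T) ω i ∂μ with hc
  let F : ℕ → ℕ → Ω → ENNReal := fun N n ω =>
    ENNReal.ofReal (∑ i, frozenPortfolio K S x B N n ω i * Z (timeEnd T) ω i)
  have hFm : ∀ N n, Measurable (F N n) := fun N n =>
    (Finset.measurable_sum _ fun i _ => (measurable_frozenPortfolio hSm hB.1.adapted N n i).mul
      (hZ.measurable_coord _ i)).ennreal_ofReal
  -- Fatou in the mesh at fixed `N`; the total error vanishes by dominated convergence.
  have hFN : ∀ N, ∫⁻ ω, liminf (fun n => F N n ω) atTop ∂μ ≤ ENNReal.ofReal c := by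
    intro N
    have hlim : Tendsto (fun n => ENNReal.ofReal (c +
        ∫ ω, ∑ i, (freezingError K S x B N n ω + localError K S x B N n (n + 1) ω) *
          Z (timeEnd T) ω i ∂μ)) atTop (𝓝 (ENNReal.ofReal (c + 0))) :=
      ENNReal.tendsto_ofReal (tendsto_const_nhds.add (tendsto_integral_error hS hK hZ hB N))
    rw [add_zero] at hlim
    refine (lintegral_liminf_le (hFm N)).trans ?_
    rw [← hlim.liminf_eq]
    refine liminf_le_liminf ?_
    filter_upwards [eventually_gt_atTop 0] with n hn
    have hint : Integrable (fun ω =>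
        ∑ i, frozenPortfolio K S x B N n ω i * Z (timeEnd T) ω i) μ := by
      refine integrable_sum_mul (fun i => hZ.integrable_coord _ i)
        (fun i => measurable_frozenPortfolio hSm hB.1.adapted N n i) (C := N + N) fun ω i => ?_
      refine (abs_add_le _ _).trans (add_le_add (abs_frozen_le N n n ω i) ?_)
      rw [abs_of_nonneg (localError_nonneg hS.pos N n _ ω)]
      exact localError_le N n _ ω
    rw [← ofReal_integral_eq_lintegral_ofReal hint (sum_frozenPortfolio_nonneg hS hZ N hn)]
    exact ENNReal.ofReal_le_ofReal (integral_frozenPortfolio_le h hS hZ hB.1 N n)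
  calc _ ≤ ∫⁻ ω, liminf (fun N => liminf (fun n => F N n ω) atTop) atTop ∂μ := by
        refine lintegral_mono_ae ?_
        filter_upwards [ae_portfolioValue_grid_mem hB] with ω hω
        obtain ⟨L, hL⟩ := exists_abs_physicalValue_le hS hK hB.1 x ω
        -- Once `N ≥ L + 1`, with `L` bounding this path, no freezing happens on fine grids; hence a
        -- second Fatou, in `N`.
        have hev : ∀ᶠ N : ℕ in atTop, liminf (fun n => F N n ω) atTop =
            ENNReal.ofReal (∑ i, physicalValue S x B (timeEnd T) ω i * Z (timeEnd T) ω i) := by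
          filter_upwards [(tendsto_natCast_atTop_atTop (R := ℝ)).eventually_ge_atTop (L + 1)]
            with N hN
          exact (ENNReal.tendsto_ofReal
            (tendsto_sum_frozenPortfolio hS hK hB.1 hω hL hN _)).liminf_eq
        rw [liminf_congr hev, liminf_const]
    _ ≤ liminf (fun N => ∫⁻ ω, liminf (fun n => F N n ω) atTop ∂μ) atTop :=
        lintegral_liminf_le fun N => .liminf (hFm N)
    _ ≤ ENNReal.ofReal c := by
        refine (liminf_le_liminf (Eventually.of_forall hFN)).trans ?_
        rw [liminf_const]

end Limit

end ConicMarket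

/-! ### Moment bounds and uniform integrability -/

namespace ConicMarket

open scoped InnerProductSpace NNReal ENNReal

/-- A family bounded in `L^r` for some `r > 1` is uniformly integrable. -/
theorem uniformIntegrable_of_lintegral_rpow_le {Ω ι : Type*} [MeasurableSpace Ω] {μ : Measure Ω}
    [IsFiniteMeasure μ] {f : ι → Ω → ℝ} (hf : ∀ i, AEStronglyMeasurable (f i) μ) {r : ℝ}
    (hr : 1 < r) {M : ℝ≥0∞} (hM : M ≠ ∞) (hfM : ∀ i, ∫⁻ ω, ‖f i ω‖ₑ ^ r ∂μ ≤ M) :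
    UniformIntegrable f 1 μ := by
  refine uniformIntegrable_of le_rfl ENNReal.one_ne_top hf fun ε hε => ?_
  have hr0 : 0 < r - 1 := sub_pos.2 hr
  -- Above the level `R ^ (1 / (r - 1))` one has `|f| ≤ |f| ^ r / R`, so the tail integral is at
  -- most `M / R ≤ ε`.
  set R : ℝ≥0 := M.toNNReal / ε.toNNReal + 1 with hR
  have hR0 : R ≠ 0 := by positivity
  refine ⟨R ^ (1 / (r - 1)), fun i => ?_⟩
  rw [eLpNorm_one_eq_lintegral_enorm]
  have hpt : ∀ ω, ‖{ω | R ^ (1 / (r - 1)) ≤ ‖f i ω‖₊}.indicator (f i) ω‖ₑ ≤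
      (R : ℝ≥0∞)⁻¹ * ‖f i ω‖ₑ ^ r := by
    intro ω
    by_cases hω : R ^ (1 / (r - 1)) ≤ ‖f i ω‖₊
    · rw [indicator_of_mem (show ω ∈ {ω | R ^ (1 / (r - 1)) ≤ ‖f i ω‖₊} from hω)]
      have h1 : R ≤ ‖f i ω‖₊ ^ (r - 1) := by
        have := NNReal.rpow_le_rpow hω hr0.le
        rwa [← NNReal.rpow_mul, one_div, inv_mul_cancel₀ hr0.ne', NNReal.rpow_one] at this
      have h2 : ‖f i ω‖₊ ≤ R⁻¹ * ‖f i ω‖₊ ^ r := by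
        have h0 : ‖f i ω‖₊ ≠ 0 := by
          intro h0
          rw [h0, NNReal.zero_rpow hr0.ne'] at h1
          exact hR0 (le_antisymm h1 bot_le)
        have h3 : ‖f i ω‖₊ ^ r = ‖f i ω‖₊ ^ (r - 1) * ‖f i ω‖₊ := by
          conv_lhs => rw [← sub_add_cancel r 1]
          rw [NNReal.rpow_add h0, NNReal.rpow_one]
        rw [h3, ← mul_assoc]
        refine le_mul_of_one_le_left bot_le ?_
        rw [← inv_mul_cancel₀ hR0]
        exact mul_le_mul_right h1 _
      rw [enorm_eq_nnnorm, ← ENNReal.coe_rpow_of_nonneg _ (by linarith), ← ENNReal.coe_inv hR0,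
        ← ENNReal.coe_mul]
      exact_mod_cast h2
    · rw [indicator_of_notMem (show ω ∉ {ω | R ^ (1 / (r - 1)) ≤ ‖f i ω‖₊} from hω)]
      simp
  have hRtop : (R : ℝ≥0∞)⁻¹ ≠ ∞ := ENNReal.inv_ne_top.2 (by exact_mod_cast hR0)
  calc _ ≤ ∫⁻ ω, (R : ℝ≥0∞)⁻¹ * ‖f i ω‖ₑ ^ r ∂μ := lintegral_mono hpt
    _ = (R : ℝ≥0∞)⁻¹ * ∫⁻ ω, ‖f i ω‖ₑ ^ r ∂μ := lintegral_const_mul' _ _ hRtop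
    _ ≤ (R : ℝ≥0∞)⁻¹ * M := mul_le_mul_right (hfM i) _
    _ ≤ ENNReal.ofReal ε := by
        rw [← ENNReal.coe_toNNReal hM, ← ENNReal.coe_inv hR0, ← ENNReal.coe_mul, ENNReal.ofReal]
        refine ENNReal.coe_le_coe.2 ?_
        have hε' : ε.toNNReal ≠ 0 := (Real.toNNReal_pos.2 hε).ne'
        rw [inv_mul_le_iff₀ (pos_iff_ne_zero.2 hR0), hR, add_mul, div_mul_cancel₀ _ hε']
        exact le_self_add

/-- Hölder's inequality bounding a moment of `g` by the mean of `g ζ` and a negative moment of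
`ζ`. -/
theorem lintegral_rpow_le_of_mul {Ω : Type*} [MeasurableSpace Ω] {μ : Measure Ω}
    {g ζ : Ω → ℝ≥0∞} (hg : Measurable g) (hζ : Measurable ζ) (hζ0 : ∀ᵐ ω ∂μ, ζ ω ≠ 0)
    (hζtop : ∀ ω, ζ ω ≠ ∞) {q : ℝ} (hq : 1 < q) :
    ∫⁻ ω, g ω ^ ((q - 1) / q) ∂μ ≤
      (∫⁻ ω, g ω * ζ ω ∂μ) ^ ((q - 1) / q) * (∫⁻ ω, ζ ω ^ (1 - q) ∂μ) ^ (1 / q) := by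
  have hq0 : 0 < q := by linarith
  set p : ℝ := (q - 1) / q with hp
  have hp0 : 0 < p := div_pos (by linarith) hq0
  -- With `p = (q - 1) / q`, Hölder is applied to `g ^ p = (g * ζ) ^ p * ζ ^ (-p)`, and `-p * q = 1
  -- - q`.
  have hpq : (1 / p).HolderConjugate q := by
    refine Real.holderConjugate_iff.2 ⟨?_, ?_⟩
    · rw [lt_div_iff₀ hp0, one_mul, hp, div_lt_one hq0]; linarith
    · rw [hp]; field_simp; ring
  have h := ENNReal.lintegral_mul_le_Lp_mul_Lq μ hpq
    (((hg.mul hζ).pow_const p).aemeasurable) ((hζ.pow_const (-p)).aemeasurable)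
  have e1 : ∀ ω, ((fun ω => (g * ζ) ω ^ p) ω) ^ (1 / p) = g ω * ζ ω := fun ω => by
    simp only [Pi.mul_apply]
    rw [← ENNReal.rpow_mul, mul_one_div_cancel hp0.ne', ENNReal.rpow_one]
  have e2 : ∀ ω, ((fun ω => ζ ω ^ (-p)) ω) ^ q = ζ ω ^ (1 - q) := fun ω => by
    rw [← ENNReal.rpow_mul]
    congr 1
    rw [hp]; field_simp; ring
  simp only [e1, e2, one_div_one_div] at h
  refine le_trans (lintegral_mono_ae ?_) h
  filter_upwards [hζ0] with ω h0
  simp only [Pi.mul_apply]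
  rw [ENNReal.mul_rpow_of_nonneg _ _ hp0.le, mul_assoc, ← ENNReal.rpow_add _ _ h0 (hζtop ω),
    add_neg_cancel, ENNReal.rpow_zero, mul_one]

/-- The liquidation value is dominated by any consistent price. -/
theorem liquidation_mul_le {d : ℕ} [NeZero d] {K : ProperCone ℝ (Vec d)} (hK : IsSolvencyCone K)
    {v z s : Vec d} (hs : ∀ i, 0 < s i) (hs0 : s 0 = 1)
    (hz : hdiv z s ∈ ProperCone.innerDual (K : Set (Vec d))) (hv : hmul s v ∈ K) :
    liquidation K (hmul s v) * z 0 ≤ ∑ i, v i * z i := by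
  have h := hz (liquidation_spec hK hv).2
  simp only [innerₗ_apply_apply, inner_sub_left, inner_smul_left, conj_trivial, inner_hdiv] at h
  have h1 : ∑ i, hmul s v i * (z i / s i) = ∑ i, v i * z i :=
    Finset.sum_congr rfl fun i _ => by
      have := (hs i).ne'
      simp only [hmul]
      field_simp
  have h2 : ∑ i, e₁ d i * (z i / s i) = z 0 := by
    rw [Finset.sum_eq_single_of_mem 0 (Finset.mem_univ _)]
    · simp [e₁, hs0]
    · intro i _ hi
      simp [e₁, hi]
  rw [h1, h2] at h
  linarith

theorem one_lt_of_one_div_lt {γ q : ℝ} (hγ : γ ∈ Ioo (0 : ℝ) 1) (hq : 1 / (1 - γ) < q) :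
    1 < q ∧ 1 < (q - 1) / q / γ := by
  have h1 : 0 < 1 - γ := by linarith [hγ.2]
  have h2 : 1 < q := lt_trans ((one_lt_div h1).2 (by linarith [hγ.1])) hq
  rw [div_lt_iff₀ h1] at hq
  refine ⟨h2, ?_⟩
  rw [one_lt_div hγ.1, lt_div_iff₀ (by linarith)]
  linarith

section Utility

variable {Ω : Type*} [mΩ : MeasurableSpace Ω] {μ : Measure Ω} {T : ℝ}
  [Fact (0 < T)] {m d : ℕ} [NeZero d] {Y : Time T → Ω → Vec m}
  {hY : ∀ t, StronglyMeasurable (Y t)} {ξ : Ω → ℝ} {hξ : Measurable ξ} {S : Time T → Ω → Vec d}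
  {K : ProperCone ℝ (Vec d)} {Z : Time T → Ω → Vec d} {x : Vec d} {B : Time T → Ω → Vec d}
  {U : Vec d × Vec d → EReal} {C γ q : ℝ}

theorem measurable_utility {𝓕 𝓖 : Filtration (Time T) mΩ} (hS : IsPriceProcess 𝓕 S)
    (hK : IsSolvencyCone K) (hB : IsStrategy 𝓖 K B) (h𝓕𝓖 : 𝓕 ≤ 𝓖) (hU : UpperSemicontinuous U) :
    Measurable fun ω =>
      (U (portfolioValue S x B (timeEnd T) ω, S (timeEnd T) ω)).toENNReal.toReal := by
  have hSm : Measurable (S (timeEnd T)) := (hS.adapted _).mono (𝓕.le _) le_rfl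
  have hVm := measurable_physicalValue hS hK hB h𝓕𝓖 x
  have hco : ∀ {X : Ω → Vec d}, Measurable X → ∀ i, Measurable fun ω => X ω i := fun hX i =>
    (EuclideanSpace.proj (𝕜 := ℝ) i : Vec d →L[ℝ] ℝ).continuous.measurable.comp hX
  have hP : Measurable (portfolioValue S x B (timeEnd T)) :=
    (WithLp.measurable_toLp 2 _).comp
      (measurable_pi_lambda _ fun i => (hco hSm i).mul (hco hVm i))
  exact (hU.measurable.comp (hP.prodMk hSm)).ereal_toENNReal.ennreal_toReal

theorem ae_utility_le (hS : IsPriceProcess (filF μ Y hY) S)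
    (hB : B ∈ admissible μ (filG μ Y hY ξ hξ) K S x)
    (hgrowth : ∀ x ∈ K, ∀ s ∈ orthant d,
      U (x, s) ≤ ((C * (1 + liquidation K x ^ γ) : ℝ) : EReal)) :
    ∀ᵐ ω ∂μ, U (portfolioValue S x B (timeEnd T) ω, S (timeEnd T) ω) ≤
      ((C * (1 + liquidation K (portfolioValue S x B (timeEnd T) ω) ^ γ) : ℝ) : EReal) := by
  filter_upwards [hB.2 (timeEnd T)] with ω hω
  exact hgrowth _ hω _ fun i => (hS.pos _ ω i).le

/-- As `1 - q < 0`, the convention `0 ^ (1 - q) = ∞` lets the finite moment exclude zeros. -/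
theorem IsCPS.ae_ne_zero {𝓕 : Filtration (Time T) mΩ} (hZ : IsCPS μ 𝓕 K S Z)
    (hq : 1 < q)
    (hI : ∫⁻ ω, ENNReal.ofReal (Z (timeEnd T) ω 0) ^ (1 - q) ∂μ < ⊤) :
    ∀ᵐ ω ∂μ, ENNReal.ofReal (Z (timeEnd T) ω 0) ≠ 0 := by
  have hm : Measurable fun ω => Z (timeEnd T) ω 0 :=
    (EuclideanSpace.proj (𝕜 := ℝ) 0 : Vec d →L[ℝ] ℝ).continuous.measurable.comp
      ((hZ.martingale.stronglyMeasurable _).mono (𝓕.le _)).measurable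
  filter_upwards [ae_lt_top (hm.ennreal_ofReal.pow_const _) hI.ne] with ω hω h0
  rw [h0, ENNReal.zero_rpow_of_neg (by linarith)] at hω
  exact lt_irrefl _ hω

/-- A moment bound, uniform over admissible strategies, for the positive part of the utility. -/
theorem lintegral_utility_rpow_le [IsProbabilityMeasure μ] (h : IsDriving μ Y ξ) (hS : IsPriceProcess (filF μ Y hY) S)
    (hK : IsSolvencyCone K) (hZ : IsCPS μ (filF μ Y hY) K S Z)
    (hB : B ∈ admissible μ (filG μ Y hY ξ hξ) K S x) (hC : 0 < C) (hγ : γ ∈ Ioo (0 : ℝ) 1)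
    (hq : 1 / (1 - γ) < q)
    (hgrowth : ∀ x ∈ K, ∀ s ∈ orthant d,
      U (x, s) ≤ ((C * (1 + liquidation K x ^ γ) : ℝ) : EReal))
    (hI : ∫⁻ ω, ENNReal.ofReal (Z (timeEnd T) ω 0) ^ (1 - q) ∂μ < ⊤) :
    ∫⁻ ω, ‖(U (portfolioValue S x B (timeEnd T) ω, S (timeEnd T) ω)).toENNReal.toReal‖ₑ ^
        ((q - 1) / q / γ) ∂μ ≤
      ENNReal.ofReal C ^ ((q - 1) / q / γ) * (2 ^ ((q - 1) / q / γ - 1) *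
        (1 + ENNReal.ofReal (∫ ω, ∑ i, |x i| * Z (timeEnd T) ω i ∂μ) ^ ((q - 1) / q) *
          (∫⁻ ω, ENNReal.ofReal (Z (timeEnd T) ω 0) ^ (1 - q) ∂μ) ^ (1 / q))) := by
  obtain ⟨hq1, hr⟩ := one_lt_of_one_div_lt hγ hq
  set r := (q - 1) / q / γ with hrdef
  have hγr : γ * r = (q - 1) / q := mul_div_cancel₀ _ hγ.1.ne'
  have hr0 : 0 < r := by linarith
  let D : Ω → ℝ := fun ω => ∑ i, physicalValue S x B (timeEnd T) ω i * Z (timeEnd T) ω i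
  -- A measurable majorant of the liquidation value, so that measurability of `ℓ` is never needed.
  let g : Ω → ℝ≥0∞ := fun ω => ENNReal.ofReal (D ω / Z (timeEnd T) ω 0)
  have hVm := measurable_physicalValue hS hK hB.1 filF_le_filG x
  have hDm : Measurable D := Finset.measurable_sum _ fun i _ =>
    ((EuclideanSpace.proj (𝕜 := ℝ) i : Vec d →L[ℝ] ℝ).continuous.measurable.comp hVm).mul
      (hZ.measurable_coord _ i)
  have hgm : Measurable g := (hDm.div (hZ.measurable_coord _ 0)).ennreal_ofReal
  have hζm : Measurable fun ω => ENNReal.ofReal (Z (timeEnd T) ω 0) :=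
    (hZ.measurable_coord _ 0).ennreal_ofReal
  have hζ0 := hZ.ae_ne_zero hq1 hI
  have hmoment : ∫⁻ ω, g ω ^ ((q - 1) / q) ∂μ ≤
      ENNReal.ofReal (∫ ω, ∑ i, |x i| * Z (timeEnd T) ω i ∂μ) ^ ((q - 1) / q) *
        (∫⁻ ω, ENNReal.ofReal (Z (timeEnd T) ω 0) ^ (1 - q) ∂μ) ^ (1 / q) := by
    refine (lintegral_rpow_le_of_mul hgm hζm hζ0 (fun _ => ENNReal.ofReal_ne_top) hq1).trans ?_
    have hbudget : ∫⁻ ω, g ω * ENNReal.ofReal (Z (timeEnd T) ω 0) ∂μ ≤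
        ENNReal.ofReal (∫ ω, ∑ i, |x i| * Z (timeEnd T) ω i ∂μ) := by
      refine le_trans (le_of_eq (lintegral_congr_ae ?_)) (lintegral_physicalValue_le h hS hK hZ hB)
      filter_upwards [hζ0] with ω h0
      have hpos : 0 < Z (timeEnd T) ω 0 := by simpa using h0
      rw [← ENNReal.ofReal_mul' hpos.le, div_mul_cancel₀ _ hpos.ne']
    exact mul_le_mul_left (ENNReal.rpow_le_rpow hbudget
      (div_nonneg (by linarith) (by linarith))) _
  have hpt : ∀ᵐ ω ∂μ,
      ‖(U (portfolioValue S x B (timeEnd T) ω, S (timeEnd T) ω)).toENNReal.toReal‖ₑ ^ r ≤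
      ENNReal.ofReal C ^ r * (2 ^ (r - 1) * (1 + g ω ^ ((q - 1) / q))) := by
    filter_upwards [ae_utility_le hS hB hgrowth, hB.2 (timeEnd T), hζ0,
      hZ.mem_dual (timeEnd T)] with ω hU hV h0 hω
    have hpos : 0 < Z (timeEnd T) ω 0 := by simpa using h0
    set ℓ := liquidation K (portfolioValue S x B (timeEnd T) ω) with hℓ
    have hℓ0 : 0 ≤ ℓ := (liquidation_spec hK hV).1
    have hℓD : ℓ ≤ D ω / Z (timeEnd T) ω 0 := by
      rw [le_div_iff₀ hpos]
      exact liquidation_mul_le hK (hS.pos _ ω) (hS.numeraire _ ω) hω.1 hV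
    have h1 : ‖(U (portfolioValue S x B (timeEnd T) ω, S (timeEnd T) ω)).toENNReal.toReal‖ₑ ≤
        ENNReal.ofReal C * (1 + g ω ^ γ) := by
      rw [Real.enorm_of_nonneg ENNReal.toReal_nonneg]
      refine ENNReal.ofReal_toReal_le.trans ((EReal.toENNReal_le_toENNReal hU).trans ?_)
      rw [EReal.real_coe_toENNReal, ENNReal.ofReal_mul hC.le,
        ENNReal.ofReal_add zero_le_one (Real.rpow_nonneg hℓ0 _), ENNReal.ofReal_one,
        ← ENNReal.ofReal_rpow_of_nonneg hℓ0 hγ.1.le]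
      have hg : ENNReal.ofReal ℓ ^ γ ≤ g ω ^ γ :=
        ENNReal.rpow_le_rpow (ENNReal.ofReal_le_ofReal hℓD) hγ.1.le
      gcongr
    calc _ ≤ (ENNReal.ofReal C * (1 + g ω ^ γ)) ^ r := ENNReal.rpow_le_rpow h1 hr0.le
      _ = ENNReal.ofReal C ^ r * (1 + g ω ^ γ) ^ r := ENNReal.mul_rpow_of_nonneg _ _ hr0.le
      _ ≤ _ := by
        refine mul_le_mul_right ?_ _
        -- Convexity of the power `r`; then `γ * r = (q - 1) / q` is the exponent of the Hölder
        -- bound.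
        have := ENNReal.rpow_add_le_mul_rpow_add_rpow 1 (g ω ^ γ) hr.le
        rwa [ENNReal.one_rpow, ← ENNReal.rpow_mul, hγr] at this
  refine (lintegral_mono_ae hpt).trans ?_
  have hgp : Measurable fun ω => g ω ^ ((q - 1) / q) := hgm.pow_const _
  rw [lintegral_const_mul _ ((hgp.const_add 1).const_mul _),
    lintegral_const_mul _ (hgp.const_add 1), lintegral_add_left measurable_const]
  simp only [lintegral_const, measure_univ, mul_one]
  gcongr

end Utility

end ConicMarket

end

theorem mainTheorem10 {Ω : Type*} [mΩ : MeasurableSpace Ω] (μ : Measure Ω)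
    [IsProbabilityMeasure μ] [μ.IsComplete] {T : ℝ} [Fact (0 < T)] {m d : ℕ} [NeZero d]
    (Y : ConicMarket.Time T → Ω → ConicMarket.Vec m) (hY : ∀ t, StronglyMeasurable (Y t))
    (ξ : Ω → ℝ) (hξ : Measurable ξ) (hYξ : ConicMarket.IsDriving μ Y ξ)
    (S : ConicMarket.Time T → Ω → ConicMarket.Vec d)
    (hS : ConicMarket.IsPriceProcess (ConicMarket.filF μ Y hY) S)
    (K : ProperCone ℝ (ConicMarket.Vec d)) (hK : ConicMarket.IsSolvencyCone K)
    (U : ConicMarket.Vec d × ConicMarket.Vec d → EReal) (hU : UpperSemicontinuous U)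
    (C γ q : ℝ) (hC : 0 < C) (hγ : γ ∈ Set.Ioo (0 : ℝ) 1) (hq : 1 / (1 - γ) < q)
    (hgrowth : ∀ x ∈ K, ∀ s ∈ ConicMarket.orthant d,
      U (x, s) ≤ ((C * (1 + ConicMarket.liquidation K x ^ γ) : ℝ) : EReal))
    (hCPS : ∃ Z, ConicMarket.IsCPS μ (ConicMarket.filF μ Y hY) K S Z ∧
      ∫⁻ ω, ENNReal.ofReal (Z (ConicMarket.timeEnd T) ω 0) ^ (1 - q) ∂μ < ⊤) :
    ConicMarket.UtilityCondition μ (ConicMarket.filG μ Y hY ξ hξ) K S U := by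
  obtain ⟨Z, hZ, hI⟩ := hCPS
  obtain ⟨hq1, hr⟩ := ConicMarket.one_lt_of_one_div_lt hγ hq
  refine ⟨hU, fun x _ => ⟨fun B hB => ?_, ?_⟩⟩
  · filter_upwards [ConicMarket.ae_utility_le hS hB hgrowth] with ω hω
    exact ne_top_of_le_ne_top (EReal.coe_ne_top _) hω
  · refine ConicMarket.uniformIntegrable_of_lintegral_rpow_le (fun B =>
      (ConicMarket.measurable_utility hS hK B.2.1 ConicMarket.filF_le_filG
        hU).aestronglyMeasurable) hr ?_ fun B =>
      ConicMarket.lintegral_utility_rpow_le hYξ hS hK hZ B.2 hC hγ hq hgrowth hI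
    -- The moment bound depends on `x` and `Z` but not on `B`; it remains to see that it is finite.
    refine ENNReal.mul_ne_top (ENNReal.rpow_ne_top_of_nonneg (by linarith) ENNReal.ofReal_ne_top)
      (ENNReal.mul_ne_top (ENNReal.rpow_ne_top_of_nonneg (by linarith) ENNReal.ofNat_ne_top)
        (ENNReal.add_ne_top.2 ⟨ENNReal.one_ne_top, ENNReal.mul_ne_top
          (ENNReal.rpow_ne_top_of_nonneg ?_ ENNReal.ofReal_ne_top)
          (ENNReal.rpow_ne_top_of_nonneg ?_ hI.ne)⟩))
    · exact div_nonneg (by linarith) (by linarith)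
    · exact one_div_nonneg.2 (by linarith)
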